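/- Let $d\ge 1$, let $\Omega\subset\mathbb R^d$ be a bounded open set with Lipschitz boundary, and let $\rho_0,\rho_1\in BV(\Omega)\cap L^\infty(\Omega)$ be nonnegative with $\operatorname{ess\,inf}_\Omega(\rho_0+\rho_1)>0$. Write $\rho=(\rho_0,\rho_1)$, and let $\mu$ be the measure on $\Omega\times\{0,1\}$ with $\mu(\,\cdot\times\{i\})=\rho_i\,dx$ for $i=0,1$; write $\mathbb E_{(x,y)\sim\mu}[f]=\int f\,d\mu$. Let $\mathfrak B(\Omega)$ be the family of Borel subsets of $\Omega$, let $\chi_A$ be the characteristic function of $A$, and let $B(x,r)$ be the open ball. A *Bayes classifier* is a minimizer of $B\mapsto\mathbb E_{(x,y)\sim\mu}[|\chi_B(x)-y|]$ over $\mathfrak B(\Omega)$. A *solution of adversarial training* with budget $\varepsilon>0$ is a minimizer of $$B\mapsto \mathbb E_{(x,y)\sim\mu}\Big[\sup_{\tilde x\in B(x,\varepsilon)\cap\Omega}|\chi_B(\tilde x)-y|\Big]$$ over $\mathfrak B(\Omega)$. For measurable $A\subset\Omega$ and $\varepsilon>0$ define the nonlocal perimeter $$\mathrm{Per}_\varepsilon(A;\rho)=\frac1\varepsilon\int_\Omega\Big(\operatorname*{ess\,sup}_{B(x,\varepsilon)\cap\Omega}\chi_A-\chi_A(x)\Big)\rho_0(x)\,dx+\frac1\varepsilon\int_\Omega\Big(\chi_A(x)-\operatorname*{ess\,inf}_{B(x,\varepsilon)\cap\Omega}\chi_A\Big)\rho_1(x)\,dx$$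 and the weighted local perimeter $$\mathrm{Per}(A;\rho)=\int_{\partial^*A\cap\Omega}\min\{\rho_0^{\nu}+\rho_1^{\nu},\ \rho_0^{-\nu}+\rho_1^{-\nu},\ \rho_0^{-\nu}+\rho_1^{\nu}\}\,d\mathcal H^{d-1}\quad\text{if }\chi_A\in BV(\Omega),\qquad \mathrm{Per}(A;\rho)=\infty\ \text{ otherwise.}$$ Here $\partial^*A$ is the reduced boundary, $\nu=D\chi_A/|D\chi_A|$ is the measure-theoretic inner normal of $A$, and $\rho_i^{\pm\nu}(x)=\lim_{r\downarrow0}$ of the average of $\rho_i$ over $\{y\in B(x,r):\langle y-x,\pm\nu\rangle>0\}$ are the one-sided traces. Let $\varepsilon_k>0$ with $\varepsilon_k\to0$, and assume the weak source condition (wSC) along this sequence: there are a Bayes classifier $A^\dagger$ with $\mathrm{Per}(A^\dagger;\rho)<\infty$ and measurable sets $A_k^\dagger\subset\Omega$ that form a recovery sequence for $A^\dagger$, i.e. $\chi_{A_k^\dagger}\to\chi_{A^\dagger}$ in $L^1(\Omega)$ and $\limsup_{k\to\infty}\mathrm{Per}_{\varepsilon_k}(A_k^\dagger;\rho)\le\mathrm{Per}(A^\dagger;\rho)$,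 such that in addition $\mathcal L^d(A^\dagger\triangle A_k^\dagger)=o(\varepsilon_k)$. Then every sequence $(A_k)$, where $A_k$ is a solution of adversarial training with budget $\varepsilon_k$, is precompact in $L^1(\Omega)$: every subsequence of $(\chi_{A_k})$ has a further subsequence that converges in $L^1(\Omega)$ to $\chi_{A_0}$ for some Borel set $A_0\subset\Omega$. -/

import Mathlib

open MeasureTheory Set Filter Topology
open scoped ENNReal NNReal

noncomputable section

namespace AdvTraining

/-- Euclidean space `ℝ^d`. -/
abbrev E (d : ℕ) : Type := EuclideanSpace ℝ (Fin d)

variable {d : ℕ}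

/-- The characteristic function `χ_A` (real valued). -/
def chi (A : Set (E d)) : E d → ℝ := A.indicator (fun _ => 1)

/-! ### Domains and functions of bounded variation -/

/-- `Ω` is a bounded open set with Lipschitz boundary: near each boundary point, `Ω` is, in suitable
orthonormal coordinates, the strict epigraph of a Lipschitz function. Here `e` is the vertical
direction, `inner ℝ e y` the height of `y`, and `y - inner ℝ e y • e` its horizontal part. -/
structure IsBoundedLipschitzDomain (Ω : Set (E d)) : Prop where
  isOpen : IsOpen Ω
  isBounded : Bornology.IsBounded Ω
  lipschitz_boundary : ∀ x ∈ frontier Ω, ∃ (r : ℝ) (e : E d) (K : ℝ≥0) (g : E d → ℝ),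
    0 < r ∧ ‖e‖ = 1 ∧ LipschitzWith K g ∧
      ∀ y ∈ Metric.ball x r, (y ∈ Ω ↔ g (y - inner ℝ e y • e) < inner ℝ e y)

/-- The divergence of a vector field. -/
def divergence (φ : E d → E d) (x : E d) : ℝ :=
  ∑ i : Fin d, (fderiv ℝ φ x (EuclideanSpace.single i 1)) i

/-- `(m, σ)` is the polar decomposition of the distributional derivative `Du` of `u` on `Ω`:
`Du = σ m`, where `m = |Du|` is a finite Borel measure carried by `Ω` and `|σ| = 1` `m`-a.e.
(The pair is unique, `σ` up to `m`-null sets.) -/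
structure IsPolarDerivative (Ω : Set (E d)) (u : E d → ℝ) (m : Measure (E d)) (σ : E d → E d) :
    Prop where
  isFinite : IsFiniteMeasure m
  carried : m Ωᶜ = 0
  measurable : Measurable σ
  norm_one : ∀ᵐ x ∂m, ‖σ x‖ = 1
  integral_div : ∀ φ : E d → E d, ContDiff ℝ 1 φ → HasCompactSupport φ → tsupport φ ⊆ Ω →
    ∫ x in Ω, u x * divergence φ x = - ∫ x, inner ℝ (φ x) (σ x) ∂m

/-- `u ∈ BV(Ω)`: `u ∈ L¹(Ω)` and its distributional derivative is a finite vector measure. -/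
def MemBV (Ω : Set (E d)) (u : E d → ℝ) : Prop :=
  IntegrableOn u Ω ∧ ∃ m σ, IsPolarDerivative Ω u m σ

open Classical in
/-- The total variation measure `|Du|` of `u ∈ BV(Ω)` (zero if `u ∉ BV(Ω)`). -/
def variationMeasure (Ω : Set (E d)) (u : E d → ℝ) : Measure (E d) :=
  if h : MemBV Ω u then h.2.choose else 0

open Classical in
/-- The density `Du / |Du|` of `u ∈ BV(Ω)` (zero if `u ∉ BV(Ω)`). -/
def polarField (Ω : Set (E d)) (u : E d → ℝ) : E d → E d :=
  if h : MemBV Ω u then h.2.choose_spec.choose else 0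

/-! ### Reduced boundary, traces and the weighted perimeter -/

/-- The quotient `Dχ_A(B(x,r)) / |Dχ_A|(B(x,r))`. -/
def normalQuotient (Ω A : Set (E d)) (x : E d) (r : ℝ) : E d :=
  ((variationMeasure Ω (chi A)).real (Metric.ball x r))⁻¹ •
    ∫ y in Metric.ball x r, polarField Ω (chi A) y ∂(variationMeasure Ω (chi A))

/-- The measure-theoretic inner normal
`ν_A(x) = lim_{r ↓ 0} Dχ_A(B(x,r)) / |Dχ_A|(B(x,r))`, meaningful on the reduced boundary. -/
def innerNormal (Ω A : Set (E d)) (x : E d) : E d :=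
  limUnder (𝓝[>] (0 : ℝ)) (normalQuotient Ω A x)

/-- The reduced boundary `∂*A ∩ Ω`: the points of `Ω` in the support of `|Dχ_A|` at which the limit
defining `ν_A` exists and has length one. -/
def reducedBoundary (Ω A : Set (E d)) : Set (E d) :=
  {x | x ∈ Ω ∧ (∀ r > 0, 0 < variationMeasure Ω (chi A) (Metric.ball x r)) ∧
    Tendsto (normalQuotient Ω A x) (𝓝[>] 0) (𝓝 (innerNormal Ω A x)) ∧ ‖innerNormal Ω A x‖ = 1}

/-- The one-sided trace `u^ν(x)`: the limit as `r ↓ 0` of the averages of `u` over the half balls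
`{y ∈ B(x,r) : ⟨y - x, ν⟩ > 0}`. -/
def oneSidedTrace (u : E d → ℝ) (ν x : E d) : ℝ :=
  limUnder (𝓝[>] (0 : ℝ)) fun r =>
    ⨍ y in Metric.ball x r ∩ {y | 0 < inner ℝ (y - x) ν}, u y

/-- The anisotropic density
`β(ν;ρ) = min {ρ₀^ν + ρ₁^ν, ρ₀^{-ν} + ρ₁^{-ν}, ρ₀^{-ν} + ρ₁^ν}`. -/
def beta (ρ₀ ρ₁ : E d → ℝ) (ν x : E d) : ℝ :=
  min (oneSidedTrace ρ₀ ν x + oneSidedTrace ρ₁ ν x)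
    (min (oneSidedTrace ρ₀ (-ν) x + oneSidedTrace ρ₁ (-ν) x)
      (oneSidedTrace ρ₀ (-ν) x + oneSidedTrace ρ₁ ν x))

open Classical in
/-- The weighted perimeter `Per(A;ρ) = ∫_{∂*A ∩ Ω} β(ν_A;ρ) dH^{d-1}` if `χ_A ∈ BV(Ω)`, and `∞`
otherwise. The Hausdorff measure is normalized so that `H^k` is Lebesgue measure on `ℝ^k`. -/
def weightedPerimeter (Ω : Set (E d)) (ρ₀ ρ₁ : E d → ℝ) (A : Set (E d)) : ℝ≥0∞ :=
  if MemBV Ω (chi A) then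
    ∫⁻ x in reducedBoundary Ω A, ENNReal.ofReal (beta ρ₀ ρ₁ (innerNormal Ω A x) x)
      ∂(Measure.euclideanHausdorffMeasure (d - 1))
  else ∞

/-- The nonlocal perimeter
`Per_ε(A;ρ) = ε⁻¹ ∫_Ω (ess sup_{B(x,ε)∩Ω} χ_A - χ_A(x)) ρ₀(x) dx
  + ε⁻¹ ∫_Ω (χ_A(x) - ess inf_{B(x,ε)∩Ω} χ_A) ρ₁(x) dx`.
For `ε > 0` both differences are nonnegative for a.e. `x ∈ Ω`. -/
def nonlocalPerimeter (Ω : Set (E d)) (ρ₀ ρ₁ : E d → ℝ) (ε : ℝ) (A : Set (E d)) : ℝ≥0∞ :=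
  ENNReal.ofReal ε⁻¹ * (∫⁻ x in Ω, ENNReal.ofReal
    ((essSup (chi A) (volume.restrict (Metric.ball x ε ∩ Ω)) - chi A x) * ρ₀ x)) +
  ENNReal.ofReal ε⁻¹ * (∫⁻ x in Ω, ENNReal.ofReal
    ((chi A x - essInf (chi A) (volume.restrict (Metric.ball x ε ∩ Ω))) * ρ₁ x))

/-! ### Adversarial training -/

/-- The measure on `Ω` with Lebesgue density `ρ`. -/
def densityMeasure (Ω : Set (E d)) (ρ : E d → ℝ) : Measure (E d) :=
  (volume.restrict Ω).withDensity fun x => ENNReal.ofReal (ρ x)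

/-- The data distribution `μ` on points with labels in `{0, 1}`, with `μ(· × {0}) = ρ₀` and
`μ(· × {1}) = ρ₁`. -/
def dataMeasure (Ω : Set (E d)) (ρ₀ ρ₁ : E d → ℝ) : Measure (E d × Fin 2) :=
  (densityMeasure Ω ρ₀).map (fun x => (x, 0)) + (densityMeasure Ω ρ₁).map (fun x => (x, 1))

/-- The loss `|χ_A(x) - y|`. -/
def loss (A : Set (E d)) (x : E d) (y : Fin 2) : ℝ≥0∞ :=
  ENNReal.ofReal |chi A x - ((y : ℕ) : ℝ)|

/-- The standard risk `E_{(x,y)∼μ} |χ_A(x) - y|`. -/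
def standardRisk (Ω : Set (E d)) (ρ₀ ρ₁ : E d → ℝ) (A : Set (E d)) : ℝ≥0∞ :=
  ∫⁻ z, loss A z.1 z.2 ∂(dataMeasure Ω ρ₀ ρ₁)

/-- The adversarial risk `E_{(x,y)∼μ} [sup_{x' ∈ B(x,ε) ∩ Ω} |χ_A(x') - y|]`. -/
def adversarialRisk (Ω : Set (E d)) (ρ₀ ρ₁ : E d → ℝ) (ε : ℝ) (A : Set (E d)) : ℝ≥0∞ :=
  ∫⁻ z, ⨆ x' ∈ Metric.ball z.1 ε ∩ Ω, loss A x' z.2 ∂(dataMeasure Ω ρ₀ ρ₁)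

/-- `A` minimizes `F` among the Borel subsets of `Ω`. -/
def IsBorelMinimizer (Ω : Set (E d)) (F : Set (E d) → ℝ≥0∞) (A : Set (E d)) : Prop :=
  (MeasurableSet A ∧ A ⊆ Ω) ∧ ∀ B, MeasurableSet B → B ⊆ Ω → F A ≤ F B

/-- A Bayes classifier: a minimizer of the standard risk. -/
def IsBayesClassifier (Ω : Set (E d)) (ρ₀ ρ₁ : E d → ℝ) (A : Set (E d)) : Prop :=
  IsBorelMinimizer Ω (standardRisk Ω ρ₀ ρ₁) A

/-- A solution of adversarial training with budget `ε`. -/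
def IsAdversarialSolution (Ω : Set (E d)) (ρ₀ ρ₁ : E d → ℝ) (ε : ℝ) (A : Set (E d)) : Prop :=
  IsBorelMinimizer Ω (adversarialRisk Ω ρ₀ ρ₁ ε) A

/-! ### Convergence and the source condition -/

/-- `χ_{A k} → χ_A` in `L¹(Ω)`. -/
def TendstoL1 (Ω : Set (E d)) (A : ℕ → Set (E d)) (A₀ : Set (E d)) : Prop :=
  Tendsto (fun k => eLpNorm (chi (A k) - chi A₀) 1 (volume.restrict Ω)) atTop (𝓝 0)

/-- `(A k)` is a recovery sequence for `A₀` along `(ε k)`, for the Gamma-convergence of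
`Per_ε(·;ρ)` to `Per(·;ρ)` in `L¹(Ω)`. -/
structure IsRecoverySequence (Ω : Set (E d)) (ρ₀ ρ₁ : E d → ℝ) (ε : ℕ → ℝ) (A : ℕ → Set (E d))
    (A₀ : Set (E d)) : Prop where
  measurable : ∀ k, MeasurableSet (A k) ∧ A k ⊆ Ω
  tendsto : TendstoL1 Ω A A₀
  limsup_le : limsup (fun k => nonlocalPerimeter Ω ρ₀ ρ₁ (ε k) (A k)) atTop ≤
    weightedPerimeter Ω ρ₀ ρ₁ A₀

/-- The weak source condition along `(ε k)`: some Bayes classifier `A†` with `Per(A†;ρ) < ∞` has a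
recovery sequence `(A k)` with `L^d(A† ∆ A k) = o(ε k)`. -/
def WeakSourceCondition (Ω : Set (E d)) (ρ₀ ρ₁ : E d → ℝ) (ε : ℕ → ℝ) : Prop :=
  ∃ A₀ : Set (E d), IsBayesClassifier Ω ρ₀ ρ₁ A₀ ∧ weightedPerimeter Ω ρ₀ ρ₁ A₀ < ∞ ∧
    ∃ A : ℕ → Set (E d), IsRecoverySequence Ω ρ₀ ρ₁ ε A A₀ ∧
      (fun k => volume.real (symmDiff A₀ (A k))) =o[atTop] ε

/-- `(χ_{A k})` is precompact in `L¹(Ω)`: each subsequence has a further subsequence converging in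
`L¹(Ω)` (and then the limit is again a characteristic function). -/
def IsPrecompactL1 (Ω : Set (E d)) (A : ℕ → Set (E d)) : Prop :=
  ∀ ψ : ℕ → ℕ, StrictMono ψ → ∃ φ : ℕ → ℕ, StrictMono φ ∧
    ∃ A₀ : Set (E d), MeasurableSet A₀ ∧ A₀ ⊆ Ω ∧ TendstoL1 Ω (fun k => A (ψ (φ k))) A₀

end AdvTraining

end

open AdvTraining

namespace AdvTraining

/-! The mass of the two `ε`-layers of a set, `layerMass`, is `ε` times its nonlocal perimeter.
Standard risk plus layer mass bounds the adversarial risk from below, and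
`exists_adversarialRisk_le` provides a competitor for which it is also an upper bound. Comparing a
solution with the recovery sequence and cancelling the Bayes risk gives layers of mass `O(ε_k)`
(`exists_eventually_layerMass_le`).

The layers see only `ρ₀` outside the set and only `ρ₁` inside it, and either density may vanish
there. The remedy is `measureReal_crossing_le`. Let `S` be a set of points that a shift by `h`, `‖h‖
< ε`, carries across the boundary. Then `S` lies in one layer and `S + h` in the other, so one
density is controlled on `S` and the other on `S + h`. Since the densities are `BV`, moving the
second mass back to `S` costs at most `‖h‖` times a total variation. Now `ρ₀ + ρ₁` is controlled on
`S`, and its lower bound `c` gives `|S| = O(ε)`.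

Chaining short shifts yields `O(‖h‖ + ε)` for longer ones (`measureReal_flipSet_le_of_short`). This
is equicontinuity under translation on compact subsets of `Ω`, and a Kolmogorov–Riesz argument
(`exists_subseq_tendstoL1`) concludes. -/

/-! ### Translations tested against `BV` functions. -/

lemma divergence_smul_const {d : ℕ} {ψ : E d → ℝ} {x : E d} (hψ : DifferentiableAt ℝ ψ x)
    (h : E d) : divergence (fun y => ψ y • h) x = fderiv ℝ ψ x h := by
  unfold divergence
  rw [fderiv_smul_const hψ]
  conv_rhs => rw [← (EuclideanSpace.basisFun (Fin d) ℝ).sum_repr h]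
  rw [map_sum]
  refine Finset.sum_congr rfl fun i _ => ?_
  simp [mul_comm]

/-- Translating a test function changes its integral against a `BV` function by at most the length
of the shift times the total variation. -/
lemma IsPolarDerivative.abs_integral_translate_sub_le {d : ℕ} {Ω : Set (E d)} {u : E d → ℝ}
    {m : Measure (E d)} {σ : E d → E d} (hm : IsPolarDerivative Ω u m σ)
    (hu : IntegrableOn u Ω) {ψ : E d → ℝ} (hψ : ContDiff ℝ 1 ψ) (hc : HasCompactSupport ψ)
    (hb : ∀ x, |ψ x| ≤ 1) {h : E d}
    (hs : ∀ x ∈ tsupport ψ, ∀ t ∈ Icc (0 : ℝ) 1, x + t • h ∈ Ω) :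
    |(∫ y in Ω, u y * ψ (y - h)) - ∫ y in Ω, u y * ψ y| ≤ ‖h‖ * m.real univ := by
  have := hm.isFinite
  have hdiff : Differentiable ℝ ψ := hψ.differentiable one_ne_zero
  have hcont' : Continuous (fderiv ℝ ψ) := hψ.continuous_fderiv one_ne_zero
  obtain ⟨C, hC⟩ := (hc.fderiv ℝ).exists_bound_of_continuous hcont'
  have hline : ∀ y : E d, ∀ t : ℝ,
      HasDerivAt (fun s : ℝ => ψ (y - s • h)) (-(fderiv ℝ ψ (y - t • h) h)) t := by
    intro y t
    have h1 : HasDerivAt (fun s : ℝ => y - s • h) (-h) t := by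
      simpa using ((hasDerivAt_id t).smul_const h).const_sub y
    have := (hdiff (y - t • h)).hasFDerivAt.comp_hasDerivAt t h1
    simpa [Function.comp_def] using this
  have key : ∀ t : ℝ, HasDerivAt (fun s : ℝ => ∫ y in Ω, u y * ψ (y - s • h))
      (∫ y in Ω, u y * -(fderiv ℝ ψ (y - t • h) h)) t := by
    intro t
    refine (hasDerivAt_integral_of_dominated_loc_of_deriv_le (s := univ)
      (bound := fun y => |u y| * (C * ‖h‖)) univ_mem (Eventually.of_forall fun s => ?_) ?_ ?_
      (ae_of_all _ fun y s _ => ?_) (hu.abs.mul_const _)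
      (ae_of_all _ fun y s _ => (hline y s).const_mul (u y))).2
    · exact hu.aestronglyMeasurable.mul
        (hψ.continuous.comp (by fun_prop)).aestronglyMeasurable
    · refine Integrable.mono' hu.abs (hu.aestronglyMeasurable.mul
        (hψ.continuous.comp (by fun_prop)).aestronglyMeasurable) (ae_of_all _ fun y => ?_)
      rw [Real.norm_eq_abs, abs_mul]
      exact mul_le_of_le_one_right (abs_nonneg _) (hb _)
    · refine hu.aestronglyMeasurable.mul (Continuous.aestronglyMeasurable ?_)
      exact ((hcont'.comp (by fun_prop)).clm_apply continuous_const).neg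
    · rw [norm_mul, norm_neg, Real.norm_eq_abs]
      exact mul_le_mul_of_nonneg_left ((ContinuousLinearMap.le_opNorm _ _).trans
        (mul_le_mul_of_nonneg_right (hC _) (norm_nonneg _))) (abs_nonneg _)
  -- The derivative in `t` is `Du` paired with the field `ψ(· - t h) h`, which is admissible because
  -- the segments from `tsupport ψ` in direction `h` stay in `Ω`.
  have bound : ∀ t ∈ Icc (0 : ℝ) 1,
      ‖∫ y in Ω, u y * -(fderiv ℝ ψ (y - t • h) h)‖ ≤ ‖h‖ * m.real univ := by
    intro t ht
    have hψt : ContDiff ℝ 1 fun y => ψ (y - t • h) := hψ.comp (contDiff_id.sub contDiff_const)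
    have hsupp : tsupport (fun y => ψ (y - t • h)) = (fun y => y - t • h) ⁻¹' tsupport ψ :=
      tsupport_comp_eq_preimage ψ (Homeomorph.subRight (t • h))
    have hct : HasCompactSupport fun y => ψ (y - t • h) :=
      hc.comp_homeomorph (Homeomorph.subRight (t • h))
    have hdiv := hm.integral_div (fun y => ψ (y - t • h) • h) (hψt.smul contDiff_const)
      hct.smul_right (by
        refine (tsupport_smul_subset_left _ _).trans ?_
        rw [hsupp]
        intro y hy
        simpa using hs _ hy t ht)
    have heq : ∀ y, divergence (fun y => ψ (y - t • h) • h) y = fderiv ℝ ψ (y - t • h) h := by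
      intro y
      rw [divergence_smul_const (hψt.differentiable one_ne_zero y), fderiv_comp_sub]
    simp only [heq] at hdiv
    simp only [mul_neg, integral_neg, norm_neg]
    rw [hdiv, norm_neg]
    refine norm_integral_le_of_norm_le_const ?_
    filter_upwards [hm.norm_one] with y hy
    refine (norm_inner_le_norm _ _).trans ?_
    rw [hy, mul_one, norm_smul]
    exact mul_le_of_le_one_left (norm_nonneg _) (hb _)
  have := norm_image_sub_le_of_norm_deriv_le_segment_01'
    (fun t _ => (key t).hasDerivWithinAt) (fun t ht => bound t (Ico_subset_Icc_self ht))
  simpa using this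

/-- Translating a bounded set `S` changes the mass that a `BV` function gives it by at most the
length of the shift times the total variation. -/
lemma IsPolarDerivative.abs_integral_indicator_translate_sub_le {d : ℕ} {Ω : Set (E d)}
    {u : E d → ℝ} {m : Measure (E d)} {σ : E d → E d} (hm : IsPolarDerivative Ω u m σ)
    (hu : IntegrableOn u Ω) {S : Set (E d)} (hS : MeasurableSet S) (hSb : Bornology.IsBounded S)
    {δ : ℝ} (hδ : 0 < δ) {h : E d}
    (hs : ∀ x ∈ Metric.cthickening δ S, ∀ t ∈ Icc (0 : ℝ) 1, x + t • h ∈ Ω) :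
    |(∫ y in Ω, u y * chi S (y - h)) - ∫ y in Ω, u y * chi S y| ≤ ‖h‖ * m.real univ := by
  have hr : ∀ n : ℕ, 0 < δ / (n + 1 : ℝ) := fun n => by positivity
  -- Mollifiers of radius at most `δ` keep the smoothed `χ_S` supported in the `δ`-thickening of
  -- `S`.
  let φ : ℕ → ContDiffBump (0 : E d) := fun n =>
    ⟨δ / (n + 1 : ℝ) / 2, δ / (n + 1 : ℝ), half_pos (hr n), half_lt_self (hr n)⟩
  let ψ : ℕ → E d → ℝ := fun n =>
    convolution ((φ n).normed volume) (chi S) (ContinuousLinearMap.lsmul ℝ ℝ) volume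
  have hSint : Integrable (chi S) :=
    (integrable_indicator_iff hS).2 (integrableOn_const hSb.measure_lt_top.ne)
  have hψc : ∀ n, ContDiff ℝ 1 (ψ n) := fun n =>
    (φ n).hasCompactSupport_normed.contDiff_convolution_left (n := 1) _
      ((φ n).contDiff_normed) hSint.locallyIntegrable
  have hψb : ∀ n x, |ψ n x| ≤ 1 := by
    intro n x
    have : ‖ψ n x‖ ≤ ∫ t, (φ n).normed volume t := by
      refine norm_integral_le_of_norm_le (φ n).integrable_normed (ae_of_all _ fun t => ?_)
      simp only [ContinuousLinearMap.lsmul_apply, norm_smul, Real.norm_eq_abs,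
        abs_of_nonneg ((φ n).nonneg_normed t)]
      refine mul_le_of_le_one_right ((φ n).nonneg_normed t) ?_
      unfold chi indicator
      split_ifs <;> simp
    rwa [(φ n).integral_normed] at this
  have hψs : ∀ n, tsupport (ψ n) ⊆ Metric.cthickening δ S := by
    intro n
    refine closure_minimal ?_ Metric.isClosed_cthickening
    refine (support_convolution_subset _).trans ?_
    rw [(φ n).support_normed_eq]
    rintro _ ⟨a, ha, b, hb, rfl⟩
    have hbS : b ∈ S := by
      by_contra hbS
      exact hb (indicator_of_notMem hbS _)
    refine Metric.mem_cthickening_of_dist_le _ b _ _ hbS ?_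
    have : ‖a‖ < δ / (n + 1 : ℝ) := by simpa using ha
    have h2 : δ / (n + 1 : ℝ) ≤ δ := div_le_self hδ.le (by linarith [n.cast_nonneg (α := ℝ)])
    simpa [dist_eq_norm] using this.le.trans h2
  have hψcs : ∀ n, HasCompactSupport (ψ n) := fun n =>
    HasCompactSupport.of_support_subset_isCompact
      (Metric.isCompact_of_isClosed_isBounded Metric.isClosed_cthickening hSb.cthickening)
      ((subset_tsupport _).trans (hψs n))
  have hlim : ∀ᵐ x ∂(volume : Measure (E d)), Tendsto (fun n => ψ n x) atTop (𝓝 (chi S x)) := by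
    -- `K = 2` is the fixed ratio of outer to inner radius, which the Lebesgue differentiation
    -- argument requires to be bounded.
    refine ContDiffBump.ae_convolution_tendsto_right_of_locallyIntegrable (K := 2) ?_
      (Eventually.of_forall fun n => ?_) hSint.locallyIntegrable
    · exact (tendsto_const_div_atTop_nhds_zero_nat δ).comp (tendsto_add_atTop_nat 1) |>.congr
        fun n => by simp [φ]
    · simp only [φ]; linarith
  have hconv : ∀ v : E d, Tendsto (fun n => ∫ y in Ω, u y * ψ n (y - v)) atTop
      (𝓝 (∫ y in Ω, u y * chi S (y - v))) := by
    intro v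
    refine tendsto_integral_of_dominated_convergence (fun y => |u y|) (fun n => ?_) hu.abs
      (fun n => ae_of_all _ fun y => ?_) ?_
    · exact hu.aestronglyMeasurable.mul
        ((hψc n).continuous.comp (by fun_prop)).aestronglyMeasurable
    · rw [Real.norm_eq_abs, abs_mul]
      exact mul_le_of_le_one_right (abs_nonneg _) (hψb n _)
    · refine ae_restrict_of_ae ?_
      filter_upwards [(measurePreserving_sub_right volume v).quasiMeasurePreserving.ae hlim]
        with y hy using hy.const_mul _
  refine le_of_tendsto ((hconv h).sub (by simpa using hconv 0)).abs
    (Eventually.of_forall fun n => ?_)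
  exact hm.abs_integral_translate_sub_le hu (hψc n) (hψcs n) (hψb n)
    fun x hx t ht => hs x (hψs n hx) t ht

/-! ### Essential suprema over balls as thickenings. -/

/-- The points all of whose neighbourhoods meet `A` in positive measure. -/
def essPart {d : ℕ} (A : Set (E d)) : Set (E d) :=
  {z | ∀ r > 0, volume (A ∩ Metric.ball z r) ≠ 0}

section essPart

variable {d : ℕ} {Ω A B : Set (E d)} {x : E d} {ε : ℝ}

lemma volume_diff_essPart (A : Set (E d)) : volume (A \ essPart A) = 0 := by
  refine measure_null_of_locally_null _ fun x hx => ?_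
  have h := hx.2
  simp only [essPart, mem_ofPred_eq, not_forall, not_not] at h
  obtain ⟨r, hr, h0⟩ := h
  refine ⟨(A \ essPart A) ∩ Metric.ball x r,
    inter_mem self_mem_nhdsWithin (mem_nhdsWithin_of_mem_nhds (Metric.ball_mem_nhds x hr)), ?_⟩
  exact measure_mono_null (inter_subset_inter_left _ sdiff_subset) h0

/-- Turns an essential condition on a ball into membership in an honest open set, so that
measurability is automatic. Only a null part of `A` lies outside `essPart A`, hence a ball meeting
`A` in positive measure meets `essPart A`. -/
lemma mem_thickening_essPart_iff :
    x ∈ Metric.thickening ε (essPart A) ↔ volume (A ∩ Metric.ball x ε) ≠ 0 := by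
  rw [Metric.mem_thickening_iff]
  constructor
  · rintro ⟨z, hz, hxz⟩ h0
    refine hz (ε - dist x z) (sub_pos.2 hxz) (measure_mono_null (inter_subset_inter_right _ ?_) h0)
    refine Metric.ball_subset_ball' ?_
    rw [dist_comm z x]; linarith
  · intro h
    by_contra! hc
    refine h (measure_mono_null ?_ (volume_diff_essPart A))
    rintro y ⟨hyA, hy⟩
    exact ⟨hyA, fun hyE => (hc y hyE).not_gt (by rwa [dist_comm])⟩

lemma ae_mem_thickening_essPart (hε : 0 < ε) (A : Set (E d)) :
    ∀ᵐ x, x ∈ A → x ∈ Metric.thickening ε (essPart A) := by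
  have h : ∀ᵐ x, x ∉ A \ essPart A := measure_eq_zero_iff_ae_notMem.1 (volume_diff_essPart A)
  filter_upwards [h] with x hx hxA
  exact Metric.self_subset_thickening hε _ (by_contra fun hE => hx ⟨hxA, hE⟩)

lemma volume_ball_inter_ne_zero (hΩ : IsOpen Ω) (hε : 0 < ε) (hx : x ∈ Ω) :
    volume (Metric.ball x ε ∩ Ω) ≠ 0 :=
  ((Metric.isOpen_ball.inter hΩ).measure_pos _ ⟨x, Metric.mem_ball_self hε, hx⟩).ne'

lemma chi_nonneg (A : Set (E d)) (x : E d) : 0 ≤ chi A x := by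
  unfold chi indicator; split_ifs <;> norm_num

lemma chi_le_one (A : Set (E d)) (x : E d) : chi A x ≤ 1 := by
  unfold chi indicator; split_ifs <;> norm_num

lemma essSup_chi (hΩ : IsOpen Ω) (hA : MeasurableSet A) (hAΩ : A ⊆ Ω) (hε : 0 < ε) (hx : x ∈ Ω) :
    essSup (chi A) (volume.restrict (Metric.ball x ε ∩ Ω)) =
      chi (Metric.thickening ε (essPart A)) x := by
  have hne : volume.restrict (Metric.ball x ε ∩ Ω) ≠ 0 := fun h =>
    volume_ball_inter_ne_zero hΩ hε hx (Measure.restrict_eq_zero.1 h)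
  have : NeBot (ae (volume.restrict (Metric.ball x ε ∩ Ω))) := ae_neBot.2 hne
  have hset : A ∩ (Metric.ball x ε ∩ Ω) = A ∩ Metric.ball x ε := by
    ext y; simp only [mem_inter_iff]; exact ⟨fun h => ⟨h.1, h.2.1⟩, fun h => ⟨h.1, h.2, hAΩ h.1⟩⟩
  by_cases h : x ∈ Metric.thickening ε (essPart A)
  · rw [chi, chi, indicator_of_mem h]
    refine le_antisymm ?_ ?_
    · exact limsup_le_of_le (isCoboundedUnder_le_of_le _ (x := 0) (chi_nonneg A))
        (Eventually.of_forall (chi_le_one A))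
    · refine le_limsup_of_frequently_le (fun hc => ?_)
        (isBoundedUnder_of ⟨1, chi_le_one A⟩)
      rw [mem_thickening_essPart_iff, ← hset, ← Measure.restrict_apply hA] at h
      refine h (measure_mono_null (fun y hy => ?_) hc)
      simp [indicator_of_mem hy]
  · have h0 : chi A =ᵐ[volume.restrict (Metric.ball x ε ∩ Ω)] fun _ => 0 := by
      rw [mem_thickening_essPart_iff, not_not, ← hset, ← Measure.restrict_apply hA] at h
      filter_upwards [measure_eq_zero_iff_ae_notMem.1 h] with y hy using indicator_of_notMem hy _
    rw [essSup_congr_ae h0, essSup_const _ hne, chi, indicator_of_notMem h]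

lemma essInf_chi (hΩ : IsOpen Ω) (hA : MeasurableSet A) (hε : 0 < ε) (hx : x ∈ Ω) :
    essInf (chi A) (volume.restrict (Metric.ball x ε ∩ Ω)) =
      1 - chi (Metric.thickening ε (essPart (Ω \ A))) x := by
  have hne : volume.restrict (Metric.ball x ε ∩ Ω) ≠ 0 := fun h =>
    volume_ball_inter_ne_zero hΩ hε hx (Measure.restrict_eq_zero.1 h)
  have : NeBot (ae (volume.restrict (Metric.ball x ε ∩ Ω))) := ae_neBot.2 hne
  have hset : Aᶜ ∩ (Metric.ball x ε ∩ Ω) = (Ω \ A) ∩ Metric.ball x ε := by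
    ext y; simp only [mem_inter_iff, Set.mem_sdiff, mem_compl_iff]; tauto
  by_cases h : x ∈ Metric.thickening ε (essPart (Ω \ A))
  · rw [chi, chi, indicator_of_mem h, sub_self]
    refine le_antisymm ?_ ?_
    · refine liminf_le_of_frequently_le (fun hc => ?_)
        (isBoundedUnder_of ⟨0, chi_nonneg A⟩)
      rw [mem_thickening_essPart_iff, ← hset, ← Measure.restrict_apply hA.compl] at h
      refine h (measure_mono_null (fun y hy => ?_) hc)
      simp [indicator_of_notMem (show y ∉ A from hy)]
    · exact le_liminf_of_le (isCoboundedUnder_ge_of_le _ (x := 1) (chi_le_one A))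
        (Eventually.of_forall (chi_nonneg A))
  · have h0 : chi A =ᵐ[volume.restrict (Metric.ball x ε ∩ Ω)] fun _ => 1 := by
      rw [mem_thickening_essPart_iff, not_not, ← hset, ← Measure.restrict_apply hA.compl] at h
      filter_upwards [measure_eq_zero_iff_ae_notMem.1 h] with y hy
      exact indicator_of_mem (not_not.1 hy) _
    rw [essInf_congr_ae h0, essInf_const _ hne, chi, indicator_of_notMem h, sub_zero]

end essPart

/-! ### Risks and nonlocal perimeter as masses of sets. -/

section risk

variable {d : ℕ} {Ω A B : Set (E d)} {ρ₀ ρ₁ ρ : E d → ℝ} {ε : ℝ}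

lemma densityMeasure_apply_of_ae_subset {S T : Set (E d)}
    (h : ∀ᵐ x, x ∈ S → x ∈ T) : densityMeasure Ω ρ S ≤ densityMeasure Ω ρ T := by
  refine measure_mono_ae ?_
  exact (withDensity_absolutelyContinuous _ _).ae_le (ae_restrict_of_ae h)

lemma densityMeasure_compl (hΩ : MeasurableSet Ω) (A : Set (E d)) :
    densityMeasure Ω ρ Aᶜ = densityMeasure Ω ρ (Ω \ A) := by
  refine measure_congr (EventuallyEq.symm ?_)
  refine (withDensity_absolutelyContinuous _ _).ae_le ?_
  filter_upwards [ae_restrict_mem hΩ] with x hx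
  exact propext ⟨fun h => h.2, fun h => ⟨hx, h⟩⟩

lemma lintegral_dataMeasure (f : E d × Fin 2 → ℝ≥0∞) :
    ∫⁻ z, f z ∂(dataMeasure Ω ρ₀ ρ₁) =
      ∫⁻ x, f (x, 0) ∂(densityMeasure Ω ρ₀) + ∫⁻ x, f (x, 1) ∂(densityMeasure Ω ρ₁) := by
  rw [dataMeasure, lintegral_add_measure, (measurableEmbedding_prod_mk_right 0).lintegral_map,
    (measurableEmbedding_prod_mk_right 1).lintegral_map]

lemma loss_zero (A : Set (E d)) (x : E d) : loss A x 0 = A.indicator 1 x := by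
  by_cases h : x ∈ A <;> simp [loss, chi, h]

lemma loss_one (A : Set (E d)) (x : E d) : loss A x 1 = Aᶜ.indicator 1 x := by
  by_cases h : x ∈ A <;> simp [loss, chi, h]

lemma iSup_indicator_ball (S : Set (E d)) (x : E d) :
    ⨆ x' ∈ Metric.ball x ε ∩ Ω, S.indicator (1 : E d → ℝ≥0∞) x' =
      (Metric.thickening ε (Ω ∩ S)).indicator 1 x := by
  by_cases h : x ∈ Metric.thickening ε (Ω ∩ S)
  · rw [indicator_of_mem h]
    obtain ⟨z, hz, hxz⟩ := Metric.mem_thickening_iff.1 h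
    refine le_antisymm (iSup₂_le fun y _ => indicator_le_self' (by simp) y) ?_
    refine le_iSup₂_of_le z ⟨by rwa [Metric.mem_ball, dist_comm], hz.1⟩ ?_
    simp [hz.2]
  · rw [indicator_of_notMem h]
    refine le_antisymm (iSup₂_le fun y hy => ?_) zero_le
    rw [indicator_of_notMem]
    exact fun hyS => h (Metric.mem_thickening_iff.2 ⟨y, ⟨hy.2, hyS⟩, by
      rw [dist_comm]; exact hy.1⟩)

lemma standardRisk_eq (hA : MeasurableSet A) :
    standardRisk Ω ρ₀ ρ₁ A = densityMeasure Ω ρ₀ A + densityMeasure Ω ρ₁ Aᶜ := by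
  simp only [standardRisk, lintegral_dataMeasure, loss_zero, loss_one]
  rw [lintegral_indicator_one hA, lintegral_indicator_one hA.compl]

lemma adversarialRisk_eq (A : Set (E d)) :
    adversarialRisk Ω ρ₀ ρ₁ ε A = densityMeasure Ω ρ₀ (Metric.thickening ε (Ω ∩ A)) +
      densityMeasure Ω ρ₁ (Metric.thickening ε (Ω \ A)) := by
  simp only [adversarialRisk, lintegral_dataMeasure, loss_zero, loss_one, iSup_indicator_ball]
  rw [lintegral_indicator_one Metric.isOpen_thickening.measurableSet,
    lintegral_indicator_one Metric.isOpen_thickening.measurableSet, sdiff_eq]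

lemma lintegral_chi_sub_chi_mul {S T : Set (E d)} (hS : MeasurableSet S) (hT : MeasurableSet T)
    (hρ : ∀ᵐ x ∂(volume.restrict Ω), 0 ≤ ρ x) :
    ∫⁻ x in Ω, ENNReal.ofReal ((chi T x - chi S x) * ρ x) = densityMeasure Ω ρ (T \ S) := by
  rw [densityMeasure, withDensity_apply _ (hT.diff hS), ← lintegral_indicator (hT.diff hS)]
  refine lintegral_congr_ae ?_
  filter_upwards [hρ] with x hx
  by_cases h1 : x ∈ T <;> by_cases h2 : x ∈ S <;> simp [chi, h1, h2, hx]

lemma nonlocalPerimeter_eq (hΩ : IsOpen Ω) (hA : MeasurableSet A) (hAΩ : A ⊆ Ω) (hε : 0 < ε)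
    (hρ₀ : ∀ᵐ x ∂(volume.restrict Ω), 0 ≤ ρ₀ x) (hρ₁ : ∀ᵐ x ∂(volume.restrict Ω), 0 ≤ ρ₁ x) :
    nonlocalPerimeter Ω ρ₀ ρ₁ ε A = ENNReal.ofReal ε⁻¹ *
      (densityMeasure Ω ρ₀ (Metric.thickening ε (essPart A) \ A) +
        densityMeasure Ω ρ₁ (Metric.thickening ε (essPart (Ω \ A)) \ (Ω \ A))) := by
  have hT : ∀ S : Set (E d), MeasurableSet (Metric.thickening ε (essPart S)) := fun S =>
    Metric.isOpen_thickening.measurableSet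
  rw [nonlocalPerimeter, mul_add, ← lintegral_chi_sub_chi_mul hA (hT _) hρ₀,
    ← lintegral_chi_sub_chi_mul (hΩ.measurableSet.diff hA) (hT _) hρ₁]
  congr 2
  · refine setLIntegral_congr_fun hΩ.measurableSet fun x hx => ?_
    simp only [essSup_chi hΩ hA hAΩ hε hx]
  · refine setLIntegral_congr_fun hΩ.measurableSet fun x hx => ?_
    simp only [essInf_chi hΩ hA hε hx]
    congr 2
    have : chi A x = 1 - chi (Ω \ A) x := by
      by_cases h : x ∈ A <;> simp [chi, h, hx]
    rw [this]; ring

/-- Adversarial training uses true suprema, the nonlocal perimeter essential ones. The witness is `Ω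
∩ essPart B`: a point of `Ω` outside `essPart B` lies in `essPart (Ω \ B)`, since otherwise a
neighbourhood of it in `Ω` would be null. The witness may differ from `B` by positive measure; only
the bound on its risk matters. -/
lemma exists_adversarialRisk_le (hΩ : IsOpen Ω) (B : Set (E d)) :
    ∃ B', MeasurableSet B' ∧ B' ⊆ Ω ∧ adversarialRisk Ω ρ₀ ρ₁ ε B' ≤
      densityMeasure Ω ρ₀ (Metric.thickening ε (essPart B)) +
        densityMeasure Ω ρ₁ (Metric.thickening ε (essPart (Ω \ B))) := by
  have hcl : IsClosed (essPart B) := by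
    refine isClosed_of_closure_subset fun z hz r hr h0 => ?_
    obtain ⟨y, hy, hzy⟩ := Metric.mem_closure_iff.1 hz r hr
    exact (mem_thickening_essPart_iff.1 (Metric.mem_thickening_iff.2 ⟨y, hy, hzy⟩)) h0
  refine ⟨Ω ∩ essPart B, hΩ.measurableSet.inter hcl.measurableSet, inter_subset_left, ?_⟩
  rw [adversarialRisk_eq]
  refine add_le_add (measure_mono (Metric.thickening_subset_of_subset _ ?_))
    (measure_mono (Metric.thickening_subset_of_subset _ ?_))
  · exact inter_subset_right.trans inter_subset_right
  · rintro z ⟨hzΩ, hz⟩ s hs h0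
    have hz' : z ∉ essPart B := fun h => hz ⟨hzΩ, h⟩
    simp only [essPart, mem_ofPred_eq, not_forall, not_not] at hz'
    obtain ⟨r, hr, hr0⟩ := hz'
    refine volume_ball_inter_ne_zero hΩ (lt_min hr hs) hzΩ ?_
    refine measure_mono_null ?_ (measure_union_null hr0 h0)
    rintro y ⟨hy, hyΩ⟩
    have hy1 : y ∈ Metric.ball z r := Metric.ball_subset_ball (min_le_left _ _) hy
    have hy2 : y ∈ Metric.ball z s := Metric.ball_subset_ball (min_le_right _ _) hy
    by_cases hyB : y ∈ B
    · exact Or.inl ⟨hyB, hy1⟩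
    · exact Or.inr ⟨⟨hyΩ, hyB⟩, hy2⟩

lemma densityMeasure_add_thickening_diff (hε : 0 < ε) (hA : MeasurableSet A) :
    densityMeasure Ω ρ A + densityMeasure Ω ρ (Metric.thickening ε (essPart A) \ A) =
      densityMeasure Ω ρ (Metric.thickening ε (essPart A)) := by
  rw [← measure_union disjoint_sdiff_right (Metric.isOpen_thickening.measurableSet.diff hA),
    union_sdiff_self]
  refine le_antisymm (densityMeasure_apply_of_ae_subset ?_) (measure_mono subset_union_right)
  filter_upwards [ae_mem_thickening_essPart hε A] with x hx h
  exact h.elim hx id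

end risk

/-! ### Layer masses of adversarial solutions are of order `ε`. -/

/-- The masses of the outer and inner `ε`-layers of `A`. -/
noncomputable def layerMass {d : ℕ} (Ω : Set (E d)) (ρ₀ ρ₁ : E d → ℝ) (ε : ℝ) (A : Set (E d)) : ℝ≥0∞ :=
  densityMeasure Ω ρ₀ (Metric.thickening ε (essPart A) \ A) +
    densityMeasure Ω ρ₁ (Metric.thickening ε (essPart (Ω \ A)) \ (Ω \ A))

section energy

variable {d : ℕ} {Ω A A₀ B : Set (E d)} {ρ₀ ρ₁ ρ : E d → ℝ} {ε : ℝ}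

lemma standardRisk_add_layerMass (hΩ : MeasurableSet Ω) (hε : 0 < ε) (hA : MeasurableSet A) :
    standardRisk Ω ρ₀ ρ₁ A + layerMass Ω ρ₀ ρ₁ ε A =
      densityMeasure Ω ρ₀ (Metric.thickening ε (essPart A)) +
        densityMeasure Ω ρ₁ (Metric.thickening ε (essPart (Ω \ A))) := by
  rw [standardRisk_eq hA, densityMeasure_compl hΩ, layerMass, add_add_add_comm,
    densityMeasure_add_thickening_diff hε hA, densityMeasure_add_thickening_diff hε (hΩ.diff hA)]

lemma densityMeasure_le (S : Set (E d)) :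
    densityMeasure Ω ρ S ≤ eLpNormEssSup ρ (volume.restrict Ω) * volume S := by
  have h : densityMeasure Ω ρ ≤ eLpNormEssSup ρ (volume.restrict Ω) • volume.restrict Ω := by
    rw [densityMeasure, ← withDensity_const]
    refine withDensity_mono ?_
    filter_upwards [ae_le_eLpNormEssSup (f := ρ) (μ := volume.restrict Ω)] with x hx
    exact (Real.ofReal_le_enorm _).trans hx
  refine (h S).trans ?_
  rw [Measure.smul_apply, smul_eq_mul]
  gcongr
  exact Measure.restrict_le_self

lemma standardRisk_le_add (hA₀ : MeasurableSet A₀) (hB : MeasurableSet B) :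
    standardRisk Ω ρ₀ ρ₁ B ≤ standardRisk Ω ρ₀ ρ₁ A₀ +
      (eLpNormEssSup ρ₀ (volume.restrict Ω) + eLpNormEssSup ρ₁ (volume.restrict Ω)) *
        volume (symmDiff A₀ B) := by
  rw [standardRisk_eq hA₀, standardRisk_eq hB, add_mul, add_add_add_comm]
  refine add_le_add ?_ ?_
  · refine le_trans ?_ (add_le_add_right (densityMeasure_le _) _)
    refine (measure_mono fun x hx => ?_).trans (measure_union_le _ _)
    by_cases h : x ∈ A₀
    · exact Or.inl h
    · exact Or.inr (Or.inr ⟨hx, h⟩)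
  · refine le_trans ?_ (add_le_add_right (densityMeasure_le _) _)
    refine (measure_mono fun x hx => ?_).trans (measure_union_le _ _)
    by_cases h : x ∈ A₀
    · exact Or.inr (Or.inl ⟨h, hx⟩)
    · exact Or.inl h

lemma standardRisk_ne_top (hρ₀ : IntegrableOn ρ₀ Ω) (hρ₁ : IntegrableOn ρ₁ Ω)
    (hA : MeasurableSet A) : standardRisk Ω ρ₀ ρ₁ A ≠ ∞ := by
  have h : ∀ {ρ : E d → ℝ}, IntegrableOn ρ Ω → ∀ S, densityMeasure Ω ρ S ≠ ∞ := by
    intro ρ hρ S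
    have : IsFiniteMeasure (densityMeasure Ω ρ) := isFiniteMeasure_withDensity_ofReal hρ.2
    exact measure_ne_top _ _
  rw [standardRisk_eq hA]
  exact ENNReal.add_ne_top.2 ⟨h hρ₀ _, h hρ₁ _⟩

/-- A solution of adversarial training has layers of at most the mass of those of a competitor, up
to the distance of the competitor from a Bayes classifier. -/
lemma IsAdversarialSolution.layerMass_le (hA : IsAdversarialSolution Ω ρ₀ ρ₁ ε A)
    (hΩ : IsOpen Ω) (hε : 0 < ε) (hA₀ : IsBayesClassifier Ω ρ₀ ρ₁ A₀)
    (hfin : standardRisk Ω ρ₀ ρ₁ A₀ ≠ ∞) (hB : MeasurableSet B) :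
    layerMass Ω ρ₀ ρ₁ ε A ≤ layerMass Ω ρ₀ ρ₁ ε B +
      (eLpNormEssSup ρ₀ (volume.restrict Ω) + eLpNormEssSup ρ₁ (volume.restrict Ω)) *
        volume (symmDiff A₀ B) := by
  obtain ⟨⟨hAm, hAΩ⟩, hmin⟩ := hA
  obtain ⟨B', hB'm, hB'Ω, hB'⟩ := exists_adversarialRisk_le (ρ₀ := ρ₀) (ρ₁ := ρ₁) (ε := ε) hΩ B
  -- Positive measure implies nonempty, so true thickenings contain the essential ones.
  have h1 : standardRisk Ω ρ₀ ρ₁ A + layerMass Ω ρ₀ ρ₁ ε A ≤ adversarialRisk Ω ρ₀ ρ₁ ε A := by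
    rw [standardRisk_add_layerMass hΩ.measurableSet hε hAm, adversarialRisk_eq]
    refine add_le_add (measure_mono fun x hx => ?_) (measure_mono fun x hx => ?_)
    all_goals
      rw [mem_thickening_essPart_iff] at hx
      obtain ⟨y, hy, hyx⟩ := nonempty_of_measure_ne_zero hx
      rw [Metric.mem_ball, dist_comm] at hyx
    · exact Metric.mem_thickening_iff.2 ⟨y, ⟨hAΩ hy, hy⟩, hyx⟩
    · exact Metric.mem_thickening_iff.2 ⟨y, hy, hyx⟩
  have h2 := (h1.trans (hmin B' hB'm hB'Ω)).trans hB'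
  rw [← standardRisk_add_layerMass hΩ.measurableSet hε hB] at h2
  have h3 := h2.trans (add_le_add_left (standardRisk_le_add (A₀ := A₀) hA₀.1.1 hB) _)
  -- Bayes minimality puts the same finite risk of `A₀` on both sides, where it cancels.
  have h4 := (add_le_add_left (hA₀.2 A hAm hAΩ) (layerMass Ω ρ₀ ρ₁ ε A)).trans h3
  rw [add_assoc] at h4
  rw [add_comm (layerMass Ω ρ₀ ρ₁ ε B)]
  exact (ENNReal.add_le_add_iff_left hfin).1 h4

/-- With the recovery set as competitor, the layer term is `ε` times a nonlocal perimeter eventually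
below `M₀`, and the error is a multiple `C` of a volume eventually at most `ε`. -/
lemma exists_eventually_layerMass_le {ε : ℕ → ℝ} {A : ℕ → Set (E d)} (hΩ : IsOpen Ω)
    (hρ₀_nonneg : ∀ᵐ x ∂(volume.restrict Ω), 0 ≤ ρ₀ x)
    (hρ₁_nonneg : ∀ᵐ x ∂(volume.restrict Ω), 0 ≤ ρ₁ x)
    (hρ₀ : IntegrableOn ρ₀ Ω) (hρ₁ : IntegrableOn ρ₁ Ω)
    (hρ₀_bdd : MemLp ρ₀ ∞ (volume.restrict Ω)) (hρ₁_bdd : MemLp ρ₁ ∞ (volume.restrict Ω))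
    (hvol : volume Ω ≠ ∞) (hε_pos : ∀ k, 0 < ε k) (hSC : WeakSourceCondition Ω ρ₀ ρ₁ ε)
    (hA : ∀ k, IsAdversarialSolution Ω ρ₀ ρ₁ (ε k) (A k)) :
    ∃ M : ℝ≥0, ∀ᶠ k in atTop, layerMass Ω ρ₀ ρ₁ (ε k) (A k) ≤ M * ENNReal.ofReal (ε k) := by
  obtain ⟨A₀, hA₀, hPer, B, ⟨hBm, -, hlim⟩, hsymm⟩ := hSC
  obtain ⟨M₀, hM₀, hM₀'⟩ := ENNReal.lt_iff_exists_nnreal_btwn.1 hPer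
  have hC : eLpNormEssSup ρ₀ (volume.restrict Ω) + eLpNormEssSup ρ₁ (volume.restrict Ω) ≠ ∞ := by
    have h0 := hρ₀_bdd.2.ne
    have h1 := hρ₁_bdd.2.ne
    rw [eLpNorm_exponent_top] at h0 h1
    exact ENNReal.add_ne_top.2 ⟨h0, h1⟩
  lift eLpNormEssSup ρ₀ (volume.restrict Ω) + eLpNormEssSup ρ₁ (volume.restrict Ω) to ℝ≥0
    using hC with C hCeq
  refine ⟨M₀ + C, ?_⟩
  filter_upwards [eventually_lt_of_limsup_lt (hlim.trans_lt hM₀), hsymm.bound one_pos]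
    with k hk hk'
  have hle := (hA k).layerMass_le hΩ (hε_pos k) hA₀ (standardRisk_ne_top hρ₀ hρ₁ hA₀.1.1)
    (hBm k).1
  rw [← hCeq] at hle
  refine hle.trans ?_
  have hεk : ENNReal.ofReal (ε k) * ENNReal.ofReal (ε k)⁻¹ = 1 := by
    rw [← ENNReal.ofReal_mul (hε_pos k).le, mul_inv_cancel₀ (hε_pos k).ne', ENNReal.ofReal_one]
  have hPerk : layerMass Ω ρ₀ ρ₁ (ε k) (B k) =
      ENNReal.ofReal (ε k) * nonlocalPerimeter Ω ρ₀ ρ₁ (ε k) (B k) := by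
    rw [nonlocalPerimeter_eq hΩ (hBm k).1 (hBm k).2 (hε_pos k) hρ₀_nonneg hρ₁_nonneg, ← mul_assoc,
      hεk, one_mul, layerMass]
  have hfin : volume (symmDiff A₀ (B k)) ≠ ∞ :=
    measure_ne_top_of_subset (symmDiff_subset_union.trans (union_subset hA₀.1.2 (hBm k).2)) hvol
  have hvolk : volume (symmDiff A₀ (B k)) ≤ ENNReal.ofReal (ε k) := by
    rw [← ofReal_measureReal hfin]
    refine ENNReal.ofReal_le_ofReal ?_
    simpa [abs_of_pos (hε_pos k), abs_of_nonneg measureReal_nonneg] using hk'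
  rw [hPerk, mul_comm, ENNReal.coe_add, add_mul]
  gcongr

end energy

/-! ### From thin layers to equicontinuity under translation. -/

/-- The points that the translation by `h` moves into or out of `A`. -/
def flipSet {d : ℕ} (A : Set (E d)) (h : E d) : Set (E d) := {x | ¬(x ∈ A ↔ x + h ∈ A)}

section translation

variable {d : ℕ} {Ω A P Q S K : Set (E d)} {ρ ρ₀ ρ₁ ρP ρQ : E d → ℝ} {ε c : ℝ} {h : E d}

lemma integral_mul_chi (hS : MeasurableSet S) (hρ : ∀ᵐ x ∂(volume.restrict Ω), 0 ≤ ρ x)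
    (hint : IntegrableOn ρ Ω) :
    ∫ y in Ω, ρ y * chi S y = (densityMeasure Ω ρ S).toReal := by
  have h1 := lintegral_chi_sub_chi_mul (Ω := Ω) MeasurableSet.empty hS hρ
  have h0 : ∀ x : E d, chi (∅ : Set (E d)) x = 0 := fun x => by simp [chi]
  simp only [h0, sub_zero, sdiff_empty] at h1
  rw [← h1, integral_eq_lintegral_of_nonneg_ae]
  · simp only [mul_comm]
  · filter_upwards [hρ] with x hx using mul_nonneg hx (chi_nonneg _ _)
  · refine hint.aestronglyMeasurable.mul (Measurable.aestronglyMeasurable ?_)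
    exact measurable_const.indicator hS

lemma measurableSet_flipSet (hA : MeasurableSet A) (h : E d) : MeasurableSet (flipSet A h) :=
  (hA.iff (measurable_add_const h hA)).compl

/-- Almost all of `S` lies in the layer of `Q`, weighted by `ρP`, and almost all of `S + h` in the
layer of `P`, weighted by `ρQ`. The `BV` estimate for `ρQ` transports the second bound back to `S`,
where the two densities add up to at least `c`. -/
lemma measureReal_crossing_le {m : Measure (E d)} {σ : E d → E d} {L δ : ℝ}
    (hQσ : IsPolarDerivative Ω ρQ m σ)
    (hPi : IntegrableOn ρP Ω) (hQi : IntegrableOn ρQ Ω)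
    (hP0 : ∀ᵐ x ∂(volume.restrict Ω), 0 ≤ ρP x) (hQ0 : ∀ᵐ x ∂(volume.restrict Ω), 0 ≤ ρQ x)
    (hc : ∀ᵐ x ∂(volume.restrict Ω), c ≤ ρP x + ρQ x)
    (hPQ : Disjoint P Q) (hL : 0 ≤ L)
    (hlayer : densityMeasure Ω ρP (Metric.thickening ε (essPart Q) \ Q) +
      densityMeasure Ω ρQ (Metric.thickening ε (essPart P) \ P) ≤ ENNReal.ofReal L)
    (hS : MeasurableSet S) (hSb : Bornology.IsBounded S) (hSΩ : S ⊆ Ω) (hSP : S ⊆ P)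
    (hSQ : ∀ x ∈ S, x + h ∈ Q) (hh : ‖h‖ < ε) (hδ : 0 < δ)
    (hseg : ∀ x ∈ Metric.cthickening δ S, ∀ t ∈ Icc (0 : ℝ) 1, x + t • h ∈ Ω) :
    c * volume.real S ≤ L + ‖h‖ * m.real univ := by
  have hS' : MeasurableSet ((fun y => y - h) ⁻¹' S) := measurable_sub_const h hS
  have hBV := hQσ.abs_integral_indicator_translate_sub_le hQi hS hSb hδ hseg
  have hchi : ∀ y, chi S (y - h) = chi ((fun y => y - h) ⁻¹' S) y := fun y => rfl
  simp only [hchi] at hBV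
  rw [integral_mul_chi hS' hQ0 hQi, integral_mul_chi hS hQ0 hQi] at hBV
  have e1 : densityMeasure Ω ρP S ≤ densityMeasure Ω ρP (Metric.thickening ε (essPart Q) \ Q) := by
    refine densityMeasure_apply_of_ae_subset ?_
    have h0 : ∀ᵐ x : E d, x ∉ Q \ essPart Q :=
      measure_eq_zero_iff_ae_notMem.1 (volume_diff_essPart Q)
    filter_upwards [(measurePreserving_add_right volume h).quasiMeasurePreserving.ae h0]
      with x hx hxS
    refine ⟨Metric.mem_thickening_iff.2 ⟨x + h, by_contra fun hE => hx ⟨hSQ x hxS, hE⟩, ?_⟩,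
      disjoint_left.1 hPQ (hSP hxS)⟩
    simpa [dist_eq_norm] using hh
  have e2 : densityMeasure Ω ρQ ((fun y => y - h) ⁻¹' S) ≤
      densityMeasure Ω ρQ (Metric.thickening ε (essPart P) \ P) := by
    refine densityMeasure_apply_of_ae_subset ?_
    have h0 : ∀ᵐ x : E d, x ∉ P \ essPart P :=
      measure_eq_zero_iff_ae_notMem.1 (volume_diff_essPart P)
    filter_upwards [(measurePreserving_sub_right volume h).quasiMeasurePreserving.ae h0]
      with y hy hyS
    refine ⟨Metric.mem_thickening_iff.2 ⟨y - h, by_contra fun hE => hy ⟨hSP hyS, hE⟩, ?_⟩,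
      fun hyP => disjoint_left.1 hPQ hyP ?_⟩
    · simpa [dist_eq_norm] using hh
    · simpa using hSQ _ hyS
  have e3 := (add_le_add e1 e2).trans hlayer
  obtain ⟨f1, f2⟩ := ENNReal.add_ne_top.1 (ne_top_of_le_ne_top ENNReal.ofReal_ne_top e3)
  have e4 := ENNReal.toReal_mono ENNReal.ofReal_ne_top e3
  rw [ENNReal.toReal_add f1 f2, ENNReal.toReal_ofReal hL] at e4
  have e5 : c * volume.real S ≤
      (densityMeasure Ω ρP S).toReal + (densityMeasure Ω ρQ S).toReal := by
    have i1 : ∀ {ρ : E d → ℝ}, IntegrableOn ρ Ω → IntegrableOn ρ S := fun hi => hi.mono_set hSΩ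
    have i2 : ∀ {ρ : E d → ℝ}, ∫ y in Ω, ρ y * chi S y = ∫ y in S, ρ y := by
      intro ρ
      have : ∀ y, ρ y * chi S y = S.indicator ρ y := fun y => by
        by_cases hy : y ∈ S <;> simp [chi, hy]
      simp only [this]
      rw [setIntegral_indicator hS, inter_eq_self_of_subset_right hSΩ]
    rw [← integral_mul_chi hS hP0 hPi, ← integral_mul_chi hS hQ0 hQi, i2, i2,
      ← integral_add (i1 hPi) (i1 hQi)]
    have i3 : ∫ _ in S, c = c * volume.real S := by
      rw [setIntegral_const, smul_eq_mul, mul_comm]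
    rw [← i3]
    exact integral_mono_ae (integrableOn_const hSb.measure_lt_top.ne)
      ((i1 hPi).add (i1 hQi)) (ae_restrict_of_ae_restrict_of_subset hSΩ hc)
  have := neg_abs_le ((densityMeasure Ω ρQ ((fun y => y - h) ⁻¹' S)).toReal -
    (densityMeasure Ω ρQ S).toReal)
  linarith

/-- A set with layers of mass `O(ε)` changes by `O(ε)` under shifts shorter than `ε`. -/
lemma exists_measureReal_flipSet_le (hΩ : MeasurableSet Ω)
    (hρ₀_nonneg : ∀ᵐ x ∂(volume.restrict Ω), 0 ≤ ρ₀ x)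
    (hρ₁_nonneg : ∀ᵐ x ∂(volume.restrict Ω), 0 ≤ ρ₁ x)
    (hρ₀_BV : MemBV Ω ρ₀) (hρ₁_BV : MemBV Ω ρ₁) (hc0 : 0 < c)
    (hρ : ∀ᵐ x ∂(volume.restrict Ω), c ≤ ρ₀ x + ρ₁ x) (M : ℝ≥0) :
    ∃ C : ℝ, 0 ≤ C ∧ ∀ (A : Set (E d)) (ε : ℝ), MeasurableSet A → A ⊆ Ω → 0 < ε →
      layerMass Ω ρ₀ ρ₁ ε A ≤ M * ENNReal.ofReal ε →
      ∀ (K : Set (E d)) (h : E d) (δ : ℝ), MeasurableSet K → Bornology.IsBounded K →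
        ‖h‖ < ε → 0 < δ →
        (∀ x ∈ Metric.cthickening δ K, ∀ t ∈ Icc (0 : ℝ) 1, x + t • h ∈ Ω) →
        volume.real (K ∩ flipSet A h) ≤ C * ε := by
  obtain ⟨hi₀, m₀, σ₀, hσ₀⟩ := hρ₀_BV
  obtain ⟨hi₁, m₁, σ₁, hσ₁⟩ := hρ₁_BV
  -- Crossings into `A` cost `M ε + ‖h‖ |Dρ₁|(Ω)`, crossings out of `A` cost `M ε + ‖h‖ |Dρ₀|(Ω)`,
  -- and `‖h‖ < ε`.
  refine ⟨(2 * M + m₀.real univ + m₁.real univ) / c, by positivity, ?_⟩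
  intro A ε hA hAΩ hε hlayer K h δ hK hKb hh hδ hseg
  have hKΩ : ∀ x ∈ K, x ∈ Ω ∧ x + h ∈ Ω := fun x hx => by
    have hx' := hseg x (Metric.self_subset_cthickening K hx)
    exact ⟨by simpa using hx' 0 (by simp), by simpa using hx' 1 (by simp)⟩
  have hM : (M : ℝ≥0∞) * ENNReal.ofReal ε = ENNReal.ofReal (M * ε) := by
    rw [ENNReal.ofReal_mul M.coe_nonneg, ENNReal.ofReal_coe_nnreal]
  rw [hM] at hlayer
  have hL : 0 ≤ (M : ℝ) * ε := by positivity
  have hAh : MeasurableSet {x : E d | x + h ∈ A} := measurable_add_const h hA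
  have s1 : K ∩ (Ω \ A) ∩ {x | x + h ∈ A} ⊆ K := inter_subset_left.trans inter_subset_left
  have s2 : K ∩ A ∩ {x | x + h ∈ A}ᶜ ⊆ K := inter_subset_left.trans inter_subset_left
  have b1 := measureReal_crossing_le (S := K ∩ (Ω \ A) ∩ {x | x + h ∈ A}) (P := Ω \ A) (Q := A)
    hσ₁ hi₀ hi₁ hρ₀_nonneg hρ₁_nonneg hρ
    disjoint_sdiff_left hL hlayer ((hK.inter (hΩ.diff hA)).inter hAh)
    (hKb.subset s1) (fun x hx => (hKΩ x (s1 hx)).1) (fun x hx => hx.1.2) (fun x hx => hx.2) hh hδ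
    (fun x hx => hseg x (Metric.cthickening_subset_of_subset δ s1 hx))
  have b2 := measureReal_crossing_le (S := K ∩ A ∩ {x | x + h ∈ A}ᶜ) (P := A) (Q := Ω \ A)
    hσ₀ hi₁ hi₀ hρ₁_nonneg hρ₀_nonneg (by simpa only [add_comm] using hρ)
    disjoint_sdiff_right hL (by rw [add_comm]; exact hlayer)
    ((hK.inter hA).inter hAh.compl)
    (hKb.subset s2) (fun x hx => (hKΩ x (s2 hx)).1) (fun x hx => hx.1.2)
    (fun x hx => ⟨(hKΩ x (s2 hx)).2, hx.2⟩) hh hδ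
    (fun x hx => hseg x (Metric.cthickening_subset_of_subset δ s2 hx))
  have hsub : K ∩ flipSet A h ⊆
      (K ∩ (Ω \ A) ∩ {x | x + h ∈ A}) ∪ (K ∩ A ∩ {x | x + h ∈ A}ᶜ) := by
    rintro x ⟨hxK, hx⟩
    have hxΩ := (hKΩ x hxK).1
    simp only [flipSet, mem_ofPred_eq] at hx
    by_cases hxA : x ∈ A
    · exact Or.inr ⟨⟨hxK, hxA⟩, fun h' => hx ⟨fun _ => h', fun _ => hxA⟩⟩
    · exact Or.inl ⟨⟨hxK, hxΩ, hxA⟩, by_contra fun h' => hx ⟨fun h => absurd h hxA,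
        fun h => absurd h h'⟩⟩
  have hfin := hKb.measure_lt_top (μ := volume).ne
  have hv := (measureReal_mono hsub (measure_ne_top_of_subset (union_subset s1 s2) hfin)).trans
    (measureReal_union_le _ _)
  rw [div_mul_eq_mul_div, le_div_iff₀ hc0]
  have q0 : ‖h‖ * m₀.real univ ≤ ε * m₀.real univ := by gcongr
  have q1 : ‖h‖ * m₁.real univ ≤ ε * m₁.real univ := by gcongr
  nlinarith [mul_le_mul_of_nonneg_right hv hc0.le]

/-- A bound for short shifts gives one for all shifts that stay well inside `Ω`. -/
lemma measureReal_flipSet_le_of_short {C δ : ℝ} (hC : 0 ≤ C) (hε : 0 < ε)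
    (hK : IsCompact K) (hδ : 0 < δ) (hKΩ : Metric.cthickening δ K ⊆ Ω)
    (hshort : ∀ (K : Set (E d)) (h : E d) (δ : ℝ), MeasurableSet K → Bornology.IsBounded K →
        ‖h‖ < ε → 0 < δ →
        (∀ x ∈ Metric.cthickening δ K, ∀ t ∈ Icc (0 : ℝ) 1, x + t • h ∈ Ω) →
        volume.real (K ∩ flipSet A h) ≤ C * ε)
    (hh : ‖h‖ ≤ δ / 4) : volume.real (K ∩ flipSet A h) ≤ C * (‖h‖ + ε) := by
  -- The extra step makes each of the `N` equal shifts strictly shorter than `ε`, while `N ε ≤ ‖h‖ +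
  -- ε`.
  set N : ℕ := ⌊‖h‖ / ε⌋₊ + 1 with hN
  have hN0 : (0 : ℝ) < N := by positivity
  have hNle : (N : ℝ) * ε ≤ ‖h‖ + ε := by
    have := Nat.floor_le (div_nonneg (norm_nonneg h) hε.le)
    rw [le_div_iff₀ hε] at this
    rw [hN]; push_cast; linarith
  have hNlt : ‖h‖ < N * ε := by
    have := Nat.lt_floor_add_one (‖h‖ / ε)
    rw [div_lt_iff₀ hε] at this
    rw [hN]; push_cast; exact this
  set g : E d := (N : ℝ)⁻¹ • h with hg
  have hgn : (N : ℝ) * ‖g‖ = ‖h‖ := by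
    rw [hg, norm_smul, norm_inv, Real.norm_natCast, mul_inv_cancel_left₀ hN0.ne']
  have hgε : ‖g‖ < ε := by
    have := hgn ▸ hNlt
    exact lt_of_mul_lt_mul_left this hN0.le
  -- The `n`-th step is a short shift of the translate `K + n g`. Its `δ/4`-thickening, the
  -- displacement `n g` and the segment `t g` use at most three quarters of the margin `δ`.
  have hstep : ∀ n : ℕ, n < N → volume.real
      (K ∩ {x | ¬(x + (n : ℝ) • g ∈ A ↔ x + ((n : ℝ) • g + g) ∈ A)}) ≤ C * ε := by
    intro n hn
    have hng : (n : ℝ) * ‖g‖ ≤ δ / 4 := by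
      refine le_trans ?_ hh
      rw [← hgn]; gcongr
    have hg4 : ‖g‖ ≤ δ / 4 := by
      refine le_trans ?_ hh
      rw [← hgn]
      exact le_mul_of_one_le_left (norm_nonneg _) (by exact_mod_cast Nat.succ_pos _)
    set K' : Set (E d) := (fun x => x + (n : ℝ) • g) '' K with hK'
    have hK'c : IsCompact K' := hK.image (by fun_prop)
    have key := hshort K' g (δ / 4) hK'c.measurableSet hK'c.isBounded hgε (by positivity) (by
      intro x hx t ht
      rw [hK'c.cthickening_eq_biUnion_closedBall (by positivity)] at hx
      simp only [mem_iUnion, hK', mem_image, exists_prop, exists_exists_and_eq_and] at hx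
      obtain ⟨z, hz, hxz⟩ := hx
      refine hKΩ (Metric.mem_cthickening_of_dist_le _ z _ _ hz ?_)
      rw [Metric.mem_closedBall, dist_eq_norm] at hxz
      rw [dist_eq_norm]
      have e : x + t • g - z = (x - (z + (n : ℝ) • g)) + (n : ℝ) • g + t • g := by abel
      rw [e]
      refine (norm_add₃_le).trans ?_
      have e1 : ‖(n : ℝ) • g‖ ≤ δ / 4 := by rwa [norm_smul, Real.norm_natCast]
      have e2 : ‖t • g‖ ≤ δ / 4 := by
        rw [norm_smul, Real.norm_eq_abs, abs_of_nonneg ht.1]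
        exact (mul_le_of_le_one_left (norm_nonneg _) ht.2).trans hg4
      linarith)
    refine le_trans (le_of_eq ?_) key
    have hpre : K ∩ {x | ¬(x + (n : ℝ) • g ∈ A ↔ x + ((n : ℝ) • g + g) ∈ A)} =
        (fun x => x + (n : ℝ) • g) ⁻¹' (K' ∩ flipSet A g) := by
      ext x
      simp [hK', flipSet, add_assoc]
    rw [hpre, measureReal_def, measureReal_def, measure_preimage_add_right]
  have hind : ∀ n : ℕ, n ≤ N → volume.real (K ∩ flipSet A ((n : ℝ) • g)) ≤ n * (C * ε) := by
    intro n
    induction n with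
    | zero => intro _; simp [flipSet]
    | succ n ih =>
      intro hn
      have hsub : K ∩ flipSet A (((n + 1 : ℕ) : ℝ) • g) ⊆ (K ∩ flipSet A ((n : ℝ) • g)) ∪
          (K ∩ {x | ¬(x + (n : ℝ) • g ∈ A ↔ x + ((n : ℝ) • g + g) ∈ A)}) := by
        rintro x ⟨hxK, hx⟩
        have e : ((n + 1 : ℕ) : ℝ) • g = (n : ℝ) • g + g := by push_cast; rw [add_smul, one_smul]
        rw [e] at hx
        simp only [flipSet, mem_ofPred_eq] at hx
        by_cases h1 : x ∈ A ↔ x + (n : ℝ) • g ∈ A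
        · exact Or.inr ⟨hxK, fun h2 => hx (h1.trans h2)⟩
        · exact Or.inl ⟨hxK, h1⟩
      have := (measureReal_mono hsub (measure_ne_top_of_subset
        (union_subset inter_subset_left inter_subset_left) (hK.measure_lt_top (μ := volume)).ne)).trans
        (measureReal_union_le _ _)
      have h1 := ih (by omega)
      have h2 := hstep n (by omega)
      have e : ((n + 1 : ℕ) : ℝ) * (C * ε) = n * (C * ε) + C * ε := by push_cast; ring
      linarith
  have hfinal := hind N le_rfl
  rw [hg, smul_inv_smul₀ hN0.ne'] at hfinal
  nlinarith [mul_le_mul_of_nonneg_left hNle hC]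

end translation

/-! ### Comparing sets through cone averages. -/

/-- The cone `max (r - |z|) 0`, a Lipschitz averaging kernel. -/
noncomputable def cone {d : ℕ} (r : ℝ) (z : E d) : ℝ := max (r - ‖z‖) 0

/-- The convolution of `χ_B` with the cone of radius `r`. -/
noncomputable def coneAverage {d : ℕ} (r : ℝ) (B : Set (E d)) (x : E d) : ℝ :=
  ∫ y in B, cone r (y - x)

section cone

variable {d : ℕ} {Ω A B K : Set (E d)} {r η : ℝ}

lemma continuous_cone : Continuous (cone (d := d) r) := by
  unfold cone; fun_prop

lemma cone_nonneg (z : E d) : 0 ≤ cone r z := le_max_right _ _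

lemma cone_le (hr : 0 ≤ r) (z : E d) : cone r z ≤ r :=
  max_le (by linarith [norm_nonneg z]) hr

lemma abs_cone_sub_le (z w : E d) : |cone r z - cone r w| ≤ ‖z - w‖ := by
  refine (abs_max_sub_max_le_abs _ _ _).trans ?_
  rw [sub_sub_sub_cancel_left, abs_sub_comm]
  exact abs_norm_sub_norm_le z w

lemma cone_eq_zero {z : E d} (h : r ≤ ‖z‖) : cone r z = 0 := max_eq_right (by linarith)

lemma integrableOn_cone (hr : 0 ≤ r) (hB : volume B ≠ ∞) (x : E d) :
    IntegrableOn (fun y => cone r (y - x)) B := by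
  have := isFiniteMeasure_restrict.2 hB
  refine Integrable.of_bound (continuous_cone.comp (by fun_prop)).aestronglyMeasurable r
    (ae_of_all _ fun y => ?_)
  rw [Real.norm_eq_abs, abs_of_nonneg (cone_nonneg _)]
  exact cone_le hr _

lemma coneAverage_mem_Icc (hr : 0 ≤ r) (hΩ : volume Ω ≠ ∞) (hB : B ⊆ Ω) (x : E d) :
    coneAverage r B x ∈ Icc 0 (r * volume.real Ω) := by
  refine ⟨integral_nonneg fun y => cone_nonneg _, ?_⟩
  have h := norm_setIntegral_le_of_norm_le_const (μ := volume) (s := B)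
    (f := fun y => cone r (y - x)) (C := r)
    ((measure_ne_top_of_subset hB hΩ).lt_top) (fun y _ => by
      rw [Real.norm_eq_abs, abs_of_nonneg (cone_nonneg _)]; exact cone_le hr _)
  refine (Real.le_norm_self _).trans (h.trans ?_)
  exact mul_le_mul_of_nonneg_left (measureReal_mono hB hΩ) hr

lemma abs_coneAverage_sub_le (hr : 0 ≤ r) (hΩ : volume Ω ≠ ∞) (hB : B ⊆ Ω) (x q : E d) :
    |coneAverage r B x - coneAverage r B q| ≤ ‖x - q‖ * volume.real Ω := by
  have hBf := measure_ne_top_of_subset hB hΩ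
  rw [coneAverage, coneAverage,
    ← integral_sub (integrableOn_cone hr hBf x) (integrableOn_cone hr hBf q)]
  have h := norm_setIntegral_le_of_norm_le_const (μ := volume) (s := B)
    (f := fun y => cone r (y - x) - cone r (y - q)) (C := ‖x - q‖)
    hBf.lt_top (fun y _ => by
      refine (abs_cone_sub_le _ _).trans ?_
      rw [sub_sub_sub_cancel_left, norm_sub_rev])
  exact h.trans (mul_le_mul_of_nonneg_left (measureReal_mono hB hΩ) (norm_nonneg _))

lemma continuous_coneAverage (hr : 0 ≤ r) (hB : volume B ≠ ∞) : Continuous (coneAverage r B) :=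
  (LipschitzWith.of_dist_le_mul (K := (volume B).toNNReal) fun x q => by
    rw [Real.dist_eq, dist_eq_norm, mul_comm]
    exact abs_coneAverage_sub_le hr hB subset_rfl x q).continuous

lemma ofReal_coneAverage (hr : 0 ≤ r) (hBm : MeasurableSet B) (hB : volume B ≠ ∞) (x : E d) :
    ENNReal.ofReal (coneAverage r B x) =
      ∫⁻ h, B.indicator (fun _ => ENNReal.ofReal (cone r h)) (x + h) := by
  rw [coneAverage, ofReal_integral_eq_lintegral_ofReal (integrableOn_cone hr hB x)
    (ae_of_all _ fun y => cone_nonneg _), ← lintegral_indicator hBm,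
    ← lintegral_add_left_eq_self _ x]
  congr 1 with h
  by_cases hx : x + h ∈ B <;> simp [hx]

/-- The average, with the weights of the cone, of the indicators of the sets `flipSet B h`. -/
noncomputable def flipAverage (r : ℝ) (B : Set (E d)) (x : E d) : ℝ≥0∞ :=
  ∫⁻ h, (flipSet B h).indicator (fun _ => ENNReal.ofReal (cone r h)) x

/-- For each `h`, either the shift takes `x` out of `A` or `x + h ∈ A`, so the full cone mass is at
most `flipAverage r A x + coneAverage r A x`. As `x ∉ B`, every `x + h ∈ B` is a flip, so
`coneAverage r B x ≤ flipAverage r B x`. -/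
lemma lintegral_cone_le (hr : 0 ≤ r) (hAm : MeasurableSet A) (hBm : MeasurableSet B)
    (hA : volume A ≠ ∞) (hB : volume B ≠ ∞) {x : E d} (hxA : x ∈ A) (hxB : x ∉ B) :
    ∫⁻ h, ENNReal.ofReal (cone (d := d) r h) ≤ flipAverage r A x + flipAverage r B x +
      ENNReal.ofReal |coneAverage r A x - coneAverage r B x| := by
  have hmeas : ∀ {S : Set (E d)}, MeasurableSet S → Measurable
      fun h => S.indicator (fun _ => ENNReal.ofReal (cone r h)) (x + h) := by
    intro S hS
    have : (fun h => S.indicator (fun _ => ENNReal.ofReal (cone r h)) (x + h)) =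
        ((fun h => x + h) ⁻¹' S).indicator (fun h => ENNReal.ofReal (cone r h)) := by
      ext h; by_cases hh : x + h ∈ S <;> simp [hh]
    rw [this]
    exact (continuous_cone.measurable.ennreal_ofReal).indicator (measurable_const_add x hS)
  have h1 : ∫⁻ h, ENNReal.ofReal (cone (d := d) r h) ≤
      flipAverage r A x + ENNReal.ofReal (coneAverage r A x) := by
    rw [ofReal_coneAverage hr hAm hA, flipAverage, ← lintegral_add_right _ (hmeas hAm)]
    refine lintegral_mono fun h => ?_
    by_cases hh : x + h ∈ A <;> simp [hh, flipSet, hxA]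
  have h2 : ENNReal.ofReal (coneAverage r B x) ≤ flipAverage r B x := by
    rw [ofReal_coneAverage hr hBm hB, flipAverage]
    refine lintegral_mono fun h => ?_
    by_cases hh : x + h ∈ B <;> simp [hh, flipSet, hxB]
  refine h1.trans ?_
  rw [add_assoc]
  refine add_le_add le_rfl ?_
  refine le_trans ?_ (add_le_add_left h2 _)
  rw [← ENNReal.ofReal_add (coneAverage_mem_Icc hr hB subset_rfl x).1 (abs_nonneg _)]
  refine ENNReal.ofReal_le_ofReal ?_
  linarith [le_abs_self (coneAverage r A x - coneAverage r B x)]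

lemma measurableSet_flipSet_prod (hB : MeasurableSet B) :
    MeasurableSet {p : E d × E d | p.1 ∈ flipSet B p.2} :=
  ((measurable_fst hB).iff ((measurable_fst.add measurable_snd) hB)).compl

lemma measurable_flipSet_indicator (hB : MeasurableSet B) : Measurable fun p : E d × E d =>
    (flipSet B p.2).indicator (fun _ => ENNReal.ofReal (cone r p.2)) p.1 := by
  have : (fun p : E d × E d =>
      (flipSet B p.2).indicator (fun _ => ENNReal.ofReal (cone r p.2)) p.1) =
      {p : E d × E d | p.1 ∈ flipSet B p.2}.indicator
        (fun p => ENNReal.ofReal (cone r p.2)) := by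
    ext p; by_cases hh : p.1 ∈ flipSet B p.2 <;> simp [hh]
  rw [this]
  exact (continuous_cone.measurable.comp measurable_snd).ennreal_ofReal.indicator
    (measurableSet_flipSet_prod hB)

lemma measurable_flipAverage (hB : MeasurableSet B) : Measurable (flipAverage r B) :=
  (measurable_flipSet_indicator hB).lintegral_prod_right'

lemma lintegral_flipAverage_le (hB : MeasurableSet B) (hK : volume K ≠ ∞)
    (hflip : ∀ h : E d, ‖h‖ < r → volume.real (K ∩ flipSet B h) ≤ η) :
    ∫⁻ x in K, flipAverage r B x ≤
      ENNReal.ofReal η * ∫⁻ h, ENNReal.ofReal (cone (d := d) r h) := by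
  unfold flipAverage
  rw [lintegral_lintegral_swap (measurable_flipSet_indicator hB).aemeasurable,
    ← lintegral_const_mul _ continuous_cone.measurable.ennreal_ofReal]
  refine lintegral_mono fun h => ?_
  simp only
  rw [lintegral_indicator_const (measurableSet_flipSet hB h), mul_comm,
    Measure.restrict_apply (measurableSet_flipSet hB h), inter_comm]
  by_cases hh : ‖h‖ < r
  · gcongr
    rw [← ofReal_measureReal (measure_ne_top_of_subset inter_subset_left hK)]
    exact ENNReal.ofReal_le_ofReal (hflip h hh)
  · simp [cone_eq_zero (not_lt.1 hh)]

/-- Integrates the pointwise bound over `K`; Tonelli turns the flip averages into cone-weighted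
averages of the volumes of flip sets. -/
lemma volume_inter_symmDiff_le (hr : 0 ≤ r) (hAm : MeasurableSet A) (hBm : MeasurableSet B)
    (hA : volume A ≠ ∞) (hB : volume B ≠ ∞) (hK : volume K ≠ ∞)
    (hflipA : ∀ h : E d, ‖h‖ < r → volume.real (K ∩ flipSet A h) ≤ η)
    (hflipB : ∀ h : E d, ‖h‖ < r → volume.real (K ∩ flipSet B h) ≤ η) :
    (∫⁻ h, ENNReal.ofReal (cone (d := d) r h)) * volume (K ∩ symmDiff A B) ≤
      2 * ENNReal.ofReal η * (∫⁻ h, ENNReal.ofReal (cone (d := d) r h)) +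
        ∫⁻ x in K, ENNReal.ofReal |coneAverage r A x - coneAverage r B x| := by
  have hsm : MeasurableSet (symmDiff A B) := hAm.symmDiff hBm
  have h1 : (∫⁻ h, ENNReal.ofReal (cone (d := d) r h)) * volume (K ∩ symmDiff A B) ≤
      ∫⁻ x in K, (flipAverage r A x + flipAverage r B x) +
        ENNReal.ofReal |coneAverage r A x - coneAverage r B x| := by
    rw [inter_comm, ← Measure.restrict_apply hsm, ← lintegral_indicator_const hsm]
    refine lintegral_mono (indicator_le fun x hx => ?_)
    rcases hx with hx | hx
    · exact lintegral_cone_le hr hAm hBm hA hB hx.1 hx.2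
    · have := lintegral_cone_le hr hBm hAm hB hA hx.1 hx.2
      rwa [abs_sub_comm, add_comm (flipAverage r B x)] at this
  refine h1.trans ?_
  have h2 : Measurable fun x => flipAverage r A x + flipAverage r B x :=
    (measurable_flipAverage hAm).add (measurable_flipAverage hBm)
  rw [lintegral_add_left h2,
    lintegral_add_left (measurable_flipAverage hAm), mul_assoc, two_mul]
  exact add_le_add (add_le_add (lintegral_flipAverage_le hAm hK hflipA)
    (lintegral_flipAverage_le hBm hK hflipB)) le_rfl

lemma lintegral_cone_ne_zero (hr : 0 < r) : ∫⁻ h, ENNReal.ofReal (cone (d := d) r h) ≠ 0 := by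
  rw [Ne, lintegral_eq_zero_iff continuous_cone.measurable.ennreal_ofReal]
  intro h
  have hsub : Metric.ball (0 : E d) r ⊆ {x | ¬ENNReal.ofReal (cone (d := d) r x) = 0} := by
    intro x hx
    have hx' : ‖x‖ < r := by simpa using hx
    simp [cone, hx']
  exact (Metric.measure_ball_pos volume (0 : E d) hr).ne' (measure_mono_null hsub h)

lemma lintegral_cone_ne_top (hr : 0 ≤ r) : ∫⁻ h, ENNReal.ofReal (cone (d := d) r h) ≠ ∞ := by
  have hle : ∀ h : E d, ENNReal.ofReal (cone r h) ≤
      (Metric.ball (0 : E d) r).indicator (fun _ => ENNReal.ofReal r) h := by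
    intro h
    by_cases hh : ‖h‖ < r
    · rw [indicator_of_mem (by simpa using hh)]
      exact ENNReal.ofReal_le_ofReal (cone_le hr h)
    · simp [cone_eq_zero (not_lt.1 hh)]
  refine ne_top_of_le_ne_top ?_ (lintegral_mono hle)
  rw [lintegral_indicator_const Metric.isOpen_ball.measurableSet]
  exact ENNReal.mul_ne_top ENNReal.ofReal_ne_top measure_ball_lt_top.ne

end cone

/-! ### Kolmogorov–Riesz compactness for sets. -/

section compactness

variable {d : ℕ} {Ω : Set (E d)} {A : ℕ → Set (E d)}

/-- A diagonal argument: along a subsequence all cone averages converge at all points. -/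
lemma exists_subseq_cauchySeq_coneAverage (hΩ : volume Ω ≠ ∞) (hAΩ : ∀ k, A k ⊆ Ω) :
    ∃ φ : ℕ → ℕ, StrictMono φ ∧ ∀ (n : ℕ) (x : E d),
      CauchySeq fun k => coneAverage (1 / (n + 1 : ℝ)) (A (φ k)) x := by
  have hr : ∀ n : ℕ, 0 ≤ 1 / (n + 1 : ℝ) := fun n => by positivity
  -- Radii and points of a dense sequence index a compact product of intervals. The Lipschitz bound
  -- `|Ω|`, uniform in `k`, then extends convergence to all points.
  let F : ℕ → (ℕ × ℕ → ℝ) := fun k p =>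
    coneAverage (1 / (p.1 + 1 : ℝ)) (A k) (TopologicalSpace.denseSeq (E d) p.2)
  have hcomp : IsCompact (univ.pi fun p : ℕ × ℕ => Icc 0 (1 / (p.1 + 1 : ℝ) * volume.real Ω)) :=
    isCompact_univ_pi fun _ => isCompact_Icc
  obtain ⟨f, -, φ, hφ, hlim⟩ := hcomp.tendsto_subseq (x := F)
    fun k p _ => coneAverage_mem_Icc (hr p.1) hΩ (hAΩ k) _
  refine ⟨φ, hφ, fun n x => ?_⟩
  rw [Metric.cauchySeq_iff']
  intro e he
  obtain ⟨q, hq⟩ : ∃ q, ‖x - TopologicalSpace.denseSeq (E d) q‖ * volume.real Ω < e / 3 := by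
    obtain ⟨q, hq⟩ := (TopologicalSpace.denseRange_denseSeq (E d)).exists_dist_lt x
      (show 0 < e / 3 / (volume.real Ω + 1) by positivity)
    refine ⟨q, ?_⟩
    rw [dist_eq_norm, lt_div_iff₀ (by positivity)] at hq
    nlinarith [norm_nonneg (x - TopologicalSpace.denseSeq (E d) q)]
  have hq' : CauchySeq fun k => F (φ k) (n, q) :=
    ((continuous_apply (n, q)).tendsto f |>.comp hlim).cauchySeq
  obtain ⟨N, hN⟩ := Metric.cauchySeq_iff'.1 hq' (e / 3) (by positivity)
  refine ⟨N, fun k hk => ?_⟩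
  have h1 := hN k hk
  have h2 := abs_coneAverage_sub_le (hr n) hΩ (hAΩ (φ k)) x (TopologicalSpace.denseSeq (E d) q)
  have h3 := abs_coneAverage_sub_le (hr n) hΩ (hAΩ (φ N)) x (TopologicalSpace.denseSeq (E d) q)
  rw [Real.dist_eq] at h1 ⊢
  simp only [F] at h1
  rw [abs_lt] at h1 ⊢
  rw [abs_le] at h2 h3
  constructor <;> linarith [h1.1, h1.2, h2.1, h2.2, h3.1, h3.2]

lemma enorm_chi_sub_chi (A B : Set (E d)) (x : E d) :
    ‖chi A x - chi B x‖ₑ = (symmDiff A B).indicator 1 x := by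
  by_cases h1 : x ∈ A <;> by_cases h2 : x ∈ B <;> simp [chi, h1, h2, mem_symmDiff]

lemma eLpNorm_chi_sub_chi {A B : Set (E d)} (hA : MeasurableSet A) (hB : MeasurableSet B)
    (μ : Measure (E d)) : eLpNorm (chi A - chi B) 1 μ = μ (symmDiff A B) := by
  simp only [eLpNorm_one_eq_lintegral_enorm, Pi.sub_apply, enorm_chi_sub_chi]
  exact lintegral_indicator_one (hA.symmDiff hB)

/-- A sequence of sets that is Cauchy in `L¹(Ω)` converges to a set. -/
lemma exists_tendstoL1_of_cauchy (hΩm : MeasurableSet Ω) (hΩ : volume Ω ≠ ∞)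
    (hAm : ∀ k, MeasurableSet (A k))
    (hcauchy : Tendsto (fun p : ℕ × ℕ => volume.restrict Ω (symmDiff (A p.1) (A p.2))) atTop
      (𝓝 0)) :
    ∃ A₀ : Set (E d), MeasurableSet A₀ ∧ A₀ ⊆ Ω ∧ TendstoL1 Ω A A₀ := by
  have := isFiniteMeasure_restrict.2 hΩ
  have hL : ∀ k, MemLp (chi (A k)) 1 (volume.restrict Ω) := fun k =>
    (memLp_const 1).indicator (hAm k)
  have hC : CauchySeq fun k => (hL k).toLp := by
    rw [cauchySeq_iff_tendsto_dist_atTop_0]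
    refine ((ENNReal.tendsto_toReal ENNReal.zero_ne_top).comp hcauchy).congr fun p => ?_
    rw [Lp.dist_edist, Lp.edist_toLp_toLp, eLpNorm_chi_sub_chi (hAm _) (hAm _),
      Function.comp_apply]
  obtain ⟨g, hg⟩ := cauchySeq_tendsto_of_complete hC
  have hg' : Tendsto (fun k => eLpNorm (chi (A k) - ⇑g) 1 (volume.restrict Ω)) atTop (𝓝 0) := by
    rw [tendsto_iff_edist_tendsto_0] at hg
    refine hg.congr fun k => ?_
    rw [Lp.edist_def]
    exact eLpNorm_congr_ae ((hL k).coeFn_toLp.sub EventuallyEq.rfl)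
  obtain ⟨ns, -, hns⟩ := (tendstoInMeasure_of_tendsto_eLpNorm one_ne_zero
    (fun k => (hL k).1) (Lp.aestronglyMeasurable g) hg').exists_seq_tendsto_ae
  have hgm := (Lp.stronglyMeasurable g).measurable
  refine ⟨Ω ∩ g ⁻¹' {1}, hΩm.inter (hgm (measurableSet_singleton 1)), inter_subset_left, ?_⟩
  -- An a.e. convergent subsequence forces the limit into the closed set `{0, 1}`.
  have hgchi : (g : E d → ℝ) =ᵐ[volume.restrict Ω] chi (Ω ∩ g ⁻¹' {1}) := by
    filter_upwards [hns, ae_restrict_mem hΩm] with x hx hxΩ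
    have hcl : IsClosed ({0, 1} : Set ℝ) := (Set.toFinite _).isClosed
    have hmem : g x ∈ ({0, 1} : Set ℝ) := hcl.mem_of_tendsto hx (Eventually.of_forall fun k => by
      by_cases h : x ∈ A (ns k) <;> simp [chi, h])
    rcases hmem with h | h
    · rw [h, chi, indicator_of_notMem]
      simp [h]
    · rw [h, chi, indicator_of_mem]
      exact ⟨hxΩ, h⟩
  refine hg'.congr fun k => eLpNorm_congr_ae ?_
  filter_upwards [hgchi] with x hx
  simp [hx]

/-- Sets that are equicontinuous under translation, locally in `Ω`, are precompact in `L¹(Ω)`. -/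
lemma exists_subseq_tendstoL1 (hΩo : IsOpen Ω) (hΩ : volume Ω ≠ ∞)
    (hAm : ∀ k, MeasurableSet (A k)) (hAΩ : ∀ k, A k ⊆ Ω)
    (hequi : ∀ K ⊆ Ω, IsCompact K → ∀ η : ℝ, 0 < η → ∃ r > 0, ∀ᶠ k in atTop, ∀ h : E d,
      ‖h‖ < r → volume.real (K ∩ flipSet (A k) h) ≤ η) :
    ∃ φ : ℕ → ℕ, StrictMono φ ∧
      ∃ A₀ : Set (E d), MeasurableSet A₀ ∧ A₀ ⊆ Ω ∧ TendstoL1 Ω (fun k => A (φ k)) A₀ := by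
  obtain ⟨φ, hφ, hcauchy⟩ := exists_subseq_cauchySeq_coneAverage hΩ hAΩ
  refine ⟨φ, hφ, exists_tendstoL1_of_cauchy hΩo.measurableSet hΩ (fun k => hAm (φ k)) ?_⟩
  have hAf : ∀ k, volume (A k) ≠ ∞ := fun k => measure_ne_top_of_subset (hAΩ k) hΩ
  rw [ENNReal.tendsto_nhds_zero]
  intro e he
  -- The four shares of `η`: two for the flips, one for the difference of cone averages, one for `Ω
  -- \ K`.
  obtain ⟨η, hη, hηe⟩ : ∃ η : ℝ, 0 < η ∧ 4 * ENNReal.ofReal η ≤ e := by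
    rcases eq_or_ne e ∞ with rfl | hetop
    · exact ⟨1, one_pos, le_top⟩
    · refine ⟨e.toReal / 4, div_pos (ENNReal.toReal_pos he.ne' hetop) four_pos, ?_⟩
      rw [ENNReal.ofReal_div_of_pos four_pos, ENNReal.ofReal_toReal hetop]
      simp only [ENNReal.ofReal_ofNat]
      exact ENNReal.mul_div_le
  obtain ⟨K, hKΩ, hKc, hKη⟩ : ∃ K ⊆ Ω, IsCompact K ∧ volume (Ω \ K) ≤ ENNReal.ofReal η := by
    obtain ⟨K, hKΩ, hKc, hK⟩ := hΩo.measurableSet.exists_isCompact_sdiff_lt hΩ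
      (ENNReal.ofReal_pos.2 hη).ne'
    exact ⟨K, hKΩ, hKc, hK.le⟩
  have hKf : volume K ≠ ∞ := measure_ne_top_of_subset hKΩ hΩ
  obtain ⟨r, hr, hev⟩ := hequi K hKΩ hKc η hη
  -- The averages are known to converge only for the radii `1 / (n + 1)`.
  obtain ⟨n, hn⟩ := exists_nat_one_div_lt hr
  set s : ℝ := 1 / (n + 1 : ℝ) with hs
  have hs0 : 0 < s := by positivity
  set I := ∫⁻ h, ENNReal.ofReal (cone (d := d) s h) with hI
  have hI0 : I ≠ 0 := lintegral_cone_ne_zero hs0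
  have hIt : I ≠ ∞ := lintegral_cone_ne_top hs0.le
  have hdom : Tendsto (fun p : ℕ × ℕ => ∫⁻ x in K, ENNReal.ofReal
      |coneAverage s (A (φ p.1)) x - coneAverage s (A (φ p.2)) x|) atTop (𝓝 0) := by
    have h0 : (∫⁻ _ in K, (0 : ℝ≥0∞)) = 0 := lintegral_zero
    rw [← h0]
    refine tendsto_lintegral_filter_of_dominated_convergence
      (fun _ => ENNReal.ofReal (s * volume.real Ω))
      (Eventually.of_forall fun p => ?_) (Eventually.of_forall fun p => ae_of_all _ fun x => ?_)
      ?_ (ae_of_all _ fun x => ?_)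
    · exact (((continuous_coneAverage hs0.le (hAf _)).sub
        (continuous_coneAverage hs0.le (hAf _))).abs.measurable).ennreal_ofReal
    · refine ENNReal.ofReal_le_ofReal ?_
      have h1 := coneAverage_mem_Icc hs0.le hΩ (hAΩ (φ p.1)) x
      have h2 := coneAverage_mem_Icc hs0.le hΩ (hAΩ (φ p.2)) x
      rw [abs_le]
      constructor <;> linarith [h1.1, h1.2, h2.1, h2.2]
    · rw [setLIntegral_const]
      exact ENNReal.mul_ne_top ENNReal.ofReal_ne_top hKf
    · have := cauchySeq_iff_tendsto_dist_atTop_0.1 (hcauchy n x)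
      simpa only [Real.dist_eq, ENNReal.ofReal_zero] using ENNReal.tendsto_ofReal this
  have hsmall : ∀ᶠ p : ℕ × ℕ in atTop, ∫⁻ x in K, ENNReal.ofReal
      |coneAverage s (A (φ p.1)) x - coneAverage s (A (φ p.2)) x| ≤ I * ENNReal.ofReal η :=
    ENNReal.tendsto_nhds_zero.1 hdom _ (pos_iff_ne_zero.2
      (mul_ne_zero hI0 (ENNReal.ofReal_pos.2 hη).ne'))
  have hev' := hφ.tendsto_atTop.eventually hev
  rw [← prod_atTop_atTop_eq] at hsmall ⊢
  filter_upwards [hsmall, hev'.prod_mk hev'] with p hp hp'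
  have hflip : ∀ k, (∀ h : E d, ‖h‖ < r → volume.real (K ∩ flipSet (A k) h) ≤ η) →
      ∀ h : E d, ‖h‖ < s → volume.real (K ∩ flipSet (A k) h) ≤ η :=
    fun k hk h hh => hk h (hh.trans hn)
  have key := volume_inter_symmDiff_le hs0.le (hAm (φ p.1)) (hAm (φ p.2)) (hAf _) (hAf _) hKf
    (hflip _ hp'.1) (hflip _ hp'.2)
  rw [← hI] at key
  have key2 : volume (K ∩ symmDiff (A (φ p.1)) (A (φ p.2))) ≤ 3 * ENNReal.ofReal η := by
    refine (ENNReal.mul_le_mul_iff_right hI0 hIt).1 (key.trans ?_)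
    refine (add_le_add le_rfl hp).trans (le_of_eq ?_)
    ring
  refine le_trans ?_ hηe
  rw [Measure.restrict_apply ((hAm _).symmDiff (hAm _))]
  refine (measure_mono (t := (K ∩ symmDiff (A (φ p.1)) (A (φ p.2))) ∪ (Ω \ K)) ?_).trans
    ((measure_union_le _ _).trans ((add_le_add key2 hKη).trans (le_of_eq (by ring))))
  rintro x ⟨hx, hxΩ⟩
  by_cases hxK : x ∈ K
  · exact Or.inl ⟨hxK, hx⟩
  · exact Or.inr ⟨hxΩ, hxK⟩

end compactness

end AdvTraining

/-! ### Conclusion. -/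

open AdvTraining
theorem mainTheorem9 {d : ℕ} (hd : 1 ≤ d) (Ω : Set (E d)) (hΩ : IsBoundedLipschitzDomain Ω)
    (ρ₀ ρ₁ : E d → ℝ)
    (hρ₀_nonneg : ∀ᵐ x ∂(volume.restrict Ω), 0 ≤ ρ₀ x)
    (hρ₁_nonneg : ∀ᵐ x ∂(volume.restrict Ω), 0 ≤ ρ₁ x)
    (hρ₀_BV : MemBV Ω ρ₀) (hρ₁_BV : MemBV Ω ρ₁)
    (hρ₀_bdd : MemLp ρ₀ ∞ (volume.restrict Ω)) (hρ₁_bdd : MemLp ρ₁ ∞ (volume.restrict Ω))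
    (hρ : ∃ c : ℝ, 0 < c ∧ ∀ᵐ x ∂(volume.restrict Ω), c ≤ ρ₀ x + ρ₁ x)
    (ε : ℕ → ℝ) (hε_pos : ∀ k, 0 < ε k) (hε : Tendsto ε atTop (𝓝 0))
    (hSC : WeakSourceCondition Ω ρ₀ ρ₁ ε)
    (A : ℕ → Set (E d)) (hA : ∀ k, IsAdversarialSolution Ω ρ₀ ρ₁ (ε k) (A k)) :
    IsPrecompactL1 Ω A := by
  intro ψ hψ
  have hvol : volume Ω ≠ ∞ := hΩ.isBounded.measure_lt_top.ne
  obtain ⟨c, hc0, hc⟩ := hρ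
  obtain ⟨M, hM⟩ := exists_eventually_layerMass_le hΩ.isOpen hρ₀_nonneg hρ₁_nonneg hρ₀_BV.1
    hρ₁_BV.1 hρ₀_bdd hρ₁_bdd hvol hε_pos hSC hA
  obtain ⟨C, hC, hshort⟩ := exists_measureReal_flipSet_le hΩ.isOpen.measurableSet hρ₀_nonneg
    hρ₁_nonneg hρ₀_BV hρ₁_BV hc0 hc M
  refine exists_subseq_tendstoL1 (A := fun k => A (ψ k)) hΩ.isOpen hvol (fun k => (hA (ψ k)).1.1)
    (fun k => (hA (ψ k)).1.2) fun K hKΩ hK η hη => ?_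
  obtain ⟨δ, hδ, hδΩ⟩ := hK.exists_cthickening_subset_open hΩ.isOpen hKΩ
  have hη' : 0 < η / (2 * (C + 1)) := by positivity
  -- `‖h‖` and `ε` each take half of `η / (C + 1)`, where `C + 1` avoids dividing by zero; `δ / 4`
  -- is the range of the chaining bound.
  refine ⟨min (δ / 4) (η / (2 * (C + 1))), lt_min (by positivity) hη', ?_⟩
  filter_upwards [hψ.tendsto_atTop.eventually hM,
    hψ.tendsto_atTop.eventually (hε.eventually (gt_mem_nhds hη'))] with k hk hεk h hh
  have hb := measureReal_flipSet_le_of_short hC (hε_pos (ψ k)) hK hδ hδΩ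
    (hshort (A (ψ k)) (ε (ψ k)) (hA (ψ k)).1.1 (hA (ψ k)).1.2 (hε_pos _) hk)
    (hh.le.trans (min_le_left _ _))
  refine hb.trans ?_
  have h2 : ‖h‖ + ε (ψ k) ≤ η / (C + 1) := by
    have := hh.le.trans (min_le_right _ _)
    have e : η / (C + 1) = η / (2 * (C + 1)) + η / (2 * (C + 1)) := by field_simp; norm_num
    linarith
  calc C * (‖h‖ + ε (ψ k)) ≤ (C + 1) * (η / (C + 1)) :=
        mul_le_mul (by linarith) h2 (add_nonneg (norm_nonneg _) (hε_pos _).le) (by linarith)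
    _ = η := mul_div_cancel₀ _ (by positivity)
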